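/- Let $\ell$ be a prime, let $A$ be a finite group, and let $K$ be a finite extension of $\mathbb{Q}_\ell$ containing all roots of unity of order dividing the exponent of $A$, with ring of integers $\mathcal{O}$ and residue field $k$. Characters are $K$-valued. A block of a subgroup $H \le A$ is a primitive idempotent of the centre of $\mathcal{O}H$; $\mathrm{bl}(\chi)$ is the block containing $\chi\in\mathrm{Irr}(H)$, and $\mathrm{Irr}(H,b)$ is the set of irreducible characters in the block $b$. If $A$ acts on a finite group $H$, then $\mathrm{Lin}_A(H)$ denotes the set of $A$-invariant linear characters of $H$. For $N \trianglelefteq A$ and a block $b$ of $N$, Dade's ramification group $A[b]$ is the subgroup of all $g\in A$ such that $b\,C_g$ contains a unit of $b\,C$ with inverse in $b\,C_{g^{-1}}$, where $C$ is the centralizer of $\mathcal{O}N$ in $\mathcal{O}A$ and $C_g = C\cap \mathcal{O}Ng$. It contains $N$, and its elements stabilize $b$. For $N\le J\le A$ the group $J[b]$ is defined in the same way, and $J[b]=J\cap A[b]$. Let $N \le J$ be normal subgroups of $A$ such that $J/N$ is abelian and $A/N$ is solvable. Assume that $\mathrm{Lin}_A(H)=\{1_H\}$ for every $A$-stable subgroup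 $H$ of the quotient group $([A,A]J)/J$, on which $A$ acts by conjugation. Let $b$ be a block of $N$ and let $I/N$ be a Hall $\ell'$-subgroup of $A[b]/N$ such that $A=\mathrm{N}_A(I)J$. Let $\chi,\phi\in\mathrm{Irr}(N,b)$, and let $\tilde\chi\in\mathrm{Irr}(A)$ and $\tilde\phi\in\mathrm{Irr}(A[b])$ be extensions of $\chi$ and $\phi$, respectively, with $$\mathrm{bl}\bigl(\mathrm{Res}^A_{J_1}(\tilde\chi)\bigr)=\mathrm{bl}\bigl(\mathrm{Res}^{A[b]}_{J_1}(\tilde\phi)\bigr)\quad\text{for every } J_1 \text{ with } N\le J_1\le J[b].$$ Assume moreover that the block $\mathrm{bl}(\mathrm{Res}^{A[b]}_{I}(\tilde\phi))$ of $I$ is stable under conjugation by $\mathrm{N}_A(I)$. Then there exists an extension $\tilde\chi_1\in\mathrm{Irr}(A)$ of $\mathrm{Res}^A_J(\tilde\chi)$ such that $$\mathrm{bl}\bigl(\mathrm{Res}^A_{J_2}(\tilde\chi_1)\bigr)=\mathrm{bl}\bigl(\mathrm{Res}^{A[b]}_{J_2}(\tilde\phi)\bigr)\quad\text{for every } J_2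 \text{ with } N\le J_2\le A[b].$$ -/

import Mathlib

/-!
Characters of finite groups, blocks as primitive central idempotents of the group algebra over
the ring of integers of a large `ℓ`-adic field, and Dade's ramification group of a block.
-/

namespace BlockTheory

noncomputable section

/-- `χ ∈ Irr(G)`: `χ` is the character of an irreducible representation of `G` over `K`. -/
def IsIrrChar {K G : Type*} [Field K] [Group G] (χ : G → K) : Prop :=
  ∃ (n : ℕ) (ρ : Representation K G (Fin n → K)), ρ.IsIrreducible ∧ ρ.character = χ

/-- Restriction to `J` of a function on the whole group. -/
def resTop {K A : Type*} [Group A] (J : Subgroup A) (χ : A → K) : J → K :=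
  fun x => χ x

/-- Restriction to `J` of a function on a subgroup `H` containing `J`. -/
def res {K A : Type*} [Group A] {J H : Subgroup A} (h : J ≤ H) (χ : H → K) : J → K :=
  fun x => χ (Subgroup.inclusion h x)

/-- `Lin_A(H)` for a group `A` acting by automorphisms on `H` (the action being `α`): the set of
`A`-invariant linear characters of `H`. -/
def invLin (K : Type*) {A H : Type*} [Field K] [Group A] [Group H] (α : A →* MulAut H) :
    Set (H →* Kˣ) :=
  {μ | ∀ (a : A) (h : H), μ (α a h) = μ h}

/-- A block of `G` with coefficients in `R`, given by its block idempotent: a primitive idempotent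
of the centre of the group algebra `R G`. -/
structure IsBlock {R G : Type*} [CommRing R] [Group G] (e : MonoidAlgebra R G) : Prop where
  central : e ∈ Subring.center (MonoidAlgebra R G)
  idem : e * e = e
  ne_zero : e ≠ 0
  primitive : ∀ f ∈ Subring.center (MonoidAlgebra R G), f * f = f → f * e = f → f = 0 ∨ f = e

/-- The value of the linear extension of `χ : G → K` at an element of the group algebra `R G`. -/
def evalAlg {R K G : Type*} [CommRing R] [Field K] [Algebra R K]
    (χ : G → K) (x : MonoidAlgebra R G) : K :=
  x.coeff.sum fun g r => algebraMap R K r * χ g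

/-- `χ ∈ Irr(G, e)`: `χ` is irreducible and the block idempotent `e` acts as the identity on a
representation affording `χ`, that is, `χ(e) = χ(1)`. -/
def MemIrrBlock {R K G : Type*} [CommRing R] [Field K] [Algebra R K] [Group G]
    (χ : G → K) (e : MonoidAlgebra R G) : Prop :=
  IsIrrChar χ ∧ evalAlg χ e = χ 1

/-- `bl(χ) = bl(ψ)`: the irreducible characters `χ` and `ψ` of `G` belong to a common block. -/
def SameBlock (R : Type*) {K G : Type*} [CommRing R] [Field K] [Algebra R K] [Group G]
    (χ ψ : G → K) : Prop :=
  ∃ e : MonoidAlgebra R G, IsBlock e ∧ MemIrrBlock χ e ∧ MemIrrBlock ψ e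

/-- The inclusion of group algebras `R N → R A` for a subgroup `N` of `A`. -/
def incl (R : Type*) {A : Type*} [CommRing R] [Group A] (N : Subgroup A) :
    MonoidAlgebra R N →+* MonoidAlgebra R A :=
  MonoidAlgebra.mapDomainRingHom R N.subtype

/-- `bl(ψ)`, for `ψ` an irreducible character of the subgroup `I` of `A`, is stable under
conjugation by the elements of `M` (a subgroup of the normalizer of `I` in `A`). -/
def BlockStable (R : Type*) {K A : Type*} [CommRing R] [Field K] [Algebra R K] [Group A]
    {I : Subgroup A} (ψ : I → K) (M : Subgroup A) : Prop :=
  ∃ e : MonoidAlgebra R I, IsBlock e ∧ MemIrrBlock ψ e ∧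
    ∀ x ∈ M, MonoidAlgebra.of R A x * incl R I e * MonoidAlgebra.of R A x⁻¹ = incl R I e

/-- The component `C_g` of degree `N g` of the `A/N`-graded algebra `C = C_{RA}(RN)`: the elements
of `R A` that are supported on the coset `N g` and commute with the group algebra `R N`. -/
def gradedPart (R : Type*) {A : Type*} [CommRing R] [Group A] (N : Subgroup A) (g : A) :
    Set (MonoidAlgebra R A) :=
  {c | (∀ x, c.coeff x ≠ 0 → x * g⁻¹ ∈ N) ∧ ∀ x : MonoidAlgebra R N, Commute c (incl R N x)}

theorem gradedPart_mul {R A : Type*} [CommRing R] [Group A] {N : Subgroup A} [N.Normal]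
    {g h : A} {c d : MonoidAlgebra R A} (hc : c ∈ gradedPart R N g) (hd : d ∈ gradedPart R N h) :
    c * d ∈ gradedPart R N (g * h) := by
  classical
  refine ⟨fun x hx => ?_, fun x => (hc.2 x).mul_left (hd.2 x)⟩
  have hx' : x ∈ (c * d).coeff.support := Finsupp.mem_support_iff.mpr hx
  obtain ⟨y, hy, z, hz, rfl⟩ := Finset.mem_mul.mp (MonoidAlgebra.support_coeff_mul_subset c d hx')
  have h1 := hc.1 y (Finsupp.mem_support_iff.mp hy)
  have h2 := hd.1 z (Finsupp.mem_support_iff.mp hz)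
  have h3 := N.mul_mem h1 (Subgroup.Normal.conj_mem ‹N.Normal› _ h2 g)
  convert! h3 using 1
  group

theorem one_mem_gradedPart {R A : Type*} [CommRing R] [Group A] {N : Subgroup A}
    {g : A} (hg : g ∈ N) : (1 : MonoidAlgebra R A) ∈ gradedPart R N g := by
  classical
  refine ⟨fun x hx => ?_, fun x => Commute.one_left _⟩
  have : x = 1 := by
    by_contra hne
    exact hx (by rw [MonoidAlgebra.one_def, MonoidAlgebra.coeff_single,
      Finsupp.single_eq_of_ne hne])
  subst this
  simpa using hg

/-- For subgroups `N`, `H` of `A` (with `N` normal) and a block `b` of `N`, Dade's ramification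
group `H[b]`: the elements `g` of `H` for which the component `b C_g` of the graded algebra
`b C`, `C = C_{RA}(RN)`, contains a unit of `b C` with inverse in `b C_{g⁻¹}`. As `b C_1` is
local when `R` is a complete local ring, this says `(b C_g) (b C_{g⁻¹}) = b C_1`. It forces `g`
to stabilize `b`. -/
def ramificationGroup {R A : Type*} [CommRing R] [Group A] (H N : Subgroup A) [N.Normal]
    (b : MonoidAlgebra R N) : Subgroup A where
  carrier := {g | g ∈ H ∧ ∃ c ∈ gradedPart R N g, ∃ d ∈ gradedPart R N g⁻¹,
    incl R N b * (c * d) = incl R N b ∧ incl R N b * (d * c) = incl R N b}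
  one_mem' := ⟨H.one_mem, 1, one_mem_gradedPart N.one_mem, 1,
    one_mem_gradedPart (N.inv_mem N.one_mem), by simp, by simp⟩
  inv_mem' := by
    rintro g ⟨hg, c, hc, d, hd, h1, h2⟩
    exact ⟨H.inv_mem hg, d, hd, c, by simpa using hc, h2, h1⟩
  mul_mem' := by
    rintro g h ⟨hg, c, hc, d, hd, h1, h2⟩ ⟨hh, c', hc', d', hd', h1', h2'⟩
    refine ⟨H.mul_mem hg hh, c * c', gradedPart_mul hc hc', d' * d, ?_, ?_, ?_⟩
    · rw [mul_inv_rev]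
      exact gradedPart_mul hd' hd
    · calc incl R N b * (c * c' * (d' * d))
          = (incl R N b * c) * (c' * d' * d) := by noncomm_ring
        _ = c * (incl R N b * (c' * d')) * d := by rw [← (hc.2 b).eq]; noncomm_ring
        _ = incl R N b * (c * d) := by rw [h1', (hc.2 b).eq]; noncomm_ring
        _ = _ := h1
    · calc incl R N b * (d' * d * (c * c'))
          = (incl R N b * d') * (d * c * c') := by noncomm_ring
        _ = d' * (incl R N b * (d * c)) * c' := by rw [← (hd'.2 b).eq]; noncomm_ring
        _ = incl R N b * (d' * c') := by rw [h2, (hd'.2 b).eq]; noncomm_ring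
        _ = _ := h2'

theorem ramificationGroup_mono {R A : Type*} [CommRing R] [Group A] {H H' : Subgroup A}
    (h : H ≤ H') (N : Subgroup A) [N.Normal] (b : MonoidAlgebra R N) :
    ramificationGroup H N b ≤ ramificationGroup H' N b :=
  fun _ hg => ⟨h hg.1, hg.2⟩

theorem le_ramificationGroup {R A : Type*} [CommRing R] [Group A] {H N : Subgroup A} [N.Normal]
    (h : N ≤ H) (b : MonoidAlgebra R N) : N ≤ ramificationGroup H N b :=
  fun _ hg => ⟨h hg, 1, one_mem_gradedPart hg, 1, one_mem_gradedPart (N.inv_mem hg),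
    by simp, by simp⟩

/-- `I/N` is a Hall `ℓ'`-subgroup of `H/N`: we have `N ≤ I ≤ H`, the order of `I/N` is prime to
`ℓ` and the index of `I` in `H` is a power of `ℓ`. -/
structure IsHallCompl {A : Type*} [Group A] (ℓ : ℕ) (N I H : Subgroup A) : Prop where
  le_left : N ≤ I
  le_right : I ≤ H
  coprime : (N.relIndex I).Coprime ℓ
  index : ∃ n : ℕ, I.relIndex H = ℓ ^ n

end

end BlockTheory

open BlockTheory

/-! Write `O` for the ring of integers, `k` for a residue field and `H = A[b]`. Brauer's splitting
theorem (`Representation.IsIrreducible.hasScalarEnds`) shows that χ and φ have only scalar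
endomorphisms. Hence, on extensions of χ and φ to `H`, each `c` in `C_g` acts by scalars `s` and
`t`, and these lie in `O` by integrality. Two irreducible characters lie in one block exactly when
their central characters agree in `k` (`centralCharacter_congr`, `sameBlock_of_congr`).

Because `b C_g` contains a unit and χ, φ both lie in `b`, the ratio of the reductions of `t` and `s`
depends on `g` only. It defines a linear character `μ : H → kˣ` (`exists_ratio`). A central element
of `O L`, for `N ≤ L ≤ H`, is a sum of homogeneous pieces. So if a linear character ν of `A`,
trivial on `J`, reduces to μ on `H`, then the twist of χ̃ by ν has the same central characters
modulo the maximal ideal as φ̃ on every such `L` (`congr_twist_of_ratio`). This twist is the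
required extension.

To find ν, look first at `I`. For `c` in `C_g` with `g ∈ L ≤ I`, the sum of the `L/N`-conjugates of
`c` is central in `O L`, and its scalar is `|L : N|` times that of `c`. The index is invertible in
`k`, so information on blocks becomes information on μ: the equality of blocks on `I ∩ J` makes μ
trivial there, and stability of the block of `I` makes μ invariant under `N_A(I)` on `I`. The
restriction of μ to `I` lifts to roots of unity in `O`. Since `A = N_A(I) J`, the lift is an
`A`-invariant character of the normal subgroup `IJ/J` of `A/J`. Its restriction to the intersection
with the derived subgroup is invariant, hence trivial by the assumption on `Lin_A`, so it extends to
`A/J` (`exists_extension_of_invLin`). The extension ν reduces to μ on `I`, hence on all of `H`,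
because `|H : I|` is a power of ℓ and `kˣ` has no ℓ-torsion. -/

open Module Representation

/-! ### Splitting fields for quasi-elementary groups -/

section Splitting

variable {K : Type*} [Field K]

/-- The only endomorphisms of a representation are the scalars. -/
def HasScalarEnds {G V : Type*} [Monoid G] [AddCommGroup V] [Module K V]
    (ρ : Representation K G V) : Prop :=
  ∀ f : V →ₗ[K] V, (∀ g v, f (ρ g v) = ρ g (f v)) → ∃ s : K, ∀ v, f v = s • v

theorem Representation.isIrreducible_iff_forall {G V : Type*} [Monoid G] [AddCommGroup V]
    [Module K V] (ρ : Representation K G V) :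
    ρ.IsIrreducible ↔ Nontrivial V ∧
      ∀ U : Submodule K V, (∀ g, ∀ v ∈ U, ρ g v ∈ U) → U = ⊥ ∨ U = ⊤ := by
  constructor
  · intro h
    refine ⟨?_, fun U hU => ?_⟩
    · by_contra hV
      rw [not_nontrivial_iff_subsingleton] at hV
      obtain ⟨x, y, hxy⟩ := h.toNontrivial
      exact hxy (Subrepresentation.toSubmodule_injective (Subsingleton.elim _ _))
    · rcases h.eq_bot_or_eq_top (⟨U, fun g v hv => hU g v hv⟩ : Subrepresentation ρ) with h | h
      · exact Or.inl (congrArg Subrepresentation.toSubmodule h)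
      · exact Or.inr (congrArg Subrepresentation.toSubmodule h)
  · rintro ⟨hV, h⟩
    refine { exists_pair_ne := ⟨⊥, ⊤, fun h => ?_⟩, eq_bot_or_eq_top := fun U => ?_ }
    · have : (⊥ : Submodule K V) = ⊤ := congrArg Subrepresentation.toSubmodule h
      exact bot_ne_top this
    · rcases h U.toSubmodule (fun g v hv => U.apply_mem_toSubmodule g hv) with h | h
      · exact Or.inl (Subrepresentation.toSubmodule_injective h)
      · exact Or.inr (Subrepresentation.toSubmodule_injective h)

/-- The minimal polynomial divides `X ^ e - 1`, which splits over `K`. -/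
theorem exists_eigenspace_ne_bot {V : Type*} [AddCommGroup V] [Module K V] [FiniteDimensional K V]
    [Nontrivial V] {e : ℕ} [NeZero e] [HasEnoughRootsOfUnity K e] (f : End K V) (hf : f ^ e = 1) :
    ∃ s : K, f.eigenspace s ≠ ⊥ := by
  obtain ⟨ζ, hζ⟩ := HasEnoughRootsOfUnity.exists_primitiveRoot K e
  have hs := Polynomial.X_pow_sub_one_splits hζ
  have hd : minpoly K f ∣ Polynomial.X ^ e - Polynomial.C 1 := by
    apply minpoly.dvd
    simp [hf]
  have hne : (Polynomial.X ^ e - Polynomial.C 1 : Polynomial K) ≠ 0 :=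
    Polynomial.X_pow_sub_C_ne_zero (Nat.pos_of_ne_zero (NeZero.ne e)) 1
  have hs' := Polynomial.Splits.of_dvd hs hne hd
  obtain ⟨s, hs⟩ := hs'.exists_eval_eq_zero
    (ne_of_gt (minpoly.degree_pos (Algebra.IsIntegral.isIntegral f)))
  exact ⟨s, Module.End.hasEigenvalue_of_isRoot hs⟩

/-- The stabilizer of a subspace in a finite group. -/
def subspaceStabilizer {G V : Type*} [Group G] [Finite G] [AddCommGroup V] [Module K V]
    (ρ : Representation K G V) (E : Submodule K V) : Subgroup G where
  carrier := {g | ∀ v ∈ E, ρ g v ∈ E}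
  one_mem' := by simp
  mul_mem' := by
    intro a b ha hb v hv
    rw [map_mul]
    exact ha _ (hb v hv)
  inv_mem' := by
    intro a ha v hv
    have h : a⁻¹ = a ^ (orderOf a - 1) := by
      rw [inv_eq_iff_mul_eq_one, ← pow_succ', Nat.sub_add_cancel (orderOf_pos a),
        pow_orderOf_eq_one]
    rw [h]
    generalize orderOf a - 1 = n
    induction n with
    | zero => simpa using hv
    | succ n ih =>
      rw [pow_succ', map_mul]
      exact ha _ ih

/-- Restriction of a representation to an invariant subspace and its stabilizer. -/
def stabilizerRep {G V : Type*} [Group G] [Finite G] [AddCommGroup V] [Module K V]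
    (ρ : Representation K G V) (E : Submodule K V) :
    Representation K (subspaceStabilizer ρ E) E where
  toFun g := (ρ g.1).restrict g.2
  map_one' := by ext; simp
  map_mul' x y := by
    ext v
    simp only [Subgroup.coe_mul, map_mul]
    rfl

variable {G V : Type*} [Group G] [Finite G] [AddCommGroup V] [Module K V]

/-- The Clifford correspondence, with the eigenspaces of `ρ x` as the blocks of imprimitivity. -/
theorem stabilizerRep_isIrreducible (ρ : Representation K G V) (hρ : ρ.IsIrreducible) (x : G)
    (hx : ∀ (g : G) (s : K), ∃ t : K,
      ∀ v ∈ End.eigenspace (ρ x) s, ρ g v ∈ End.eigenspace (ρ x) t)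
    (s : K) (hs : End.eigenspace (ρ x) s ≠ ⊥) :
    (stabilizerRep ρ (End.eigenspace (ρ x) s)).IsIrreducible := by
  rw [Representation.isIrreducible_iff_forall] at hρ ⊢
  set E := End.eigenspace (ρ x) s with hE
  refine ⟨Submodule.nontrivial_iff_ne_bot.mpr hs, fun U hU => ?_⟩
  by_cases hUb : U = ⊥
  · exact Or.inl hUb
  right
  set U' := U.map E.subtype with hU'
  have hU'E : U' ≤ E := Submodule.map_subtype_le _ _
  set X := ⨆ t : {t : K // t ≠ s}, End.eigenspace (ρ x) t.1 with hX
  have hdisj : Disjoint E X := by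
    have := (Module.End.eigenspaces_iSupIndep (ρ x)) s
    rw [hX, iSup_subtype]
    exact this
  -- Each `g` either stabilizes `E`, hence `U'`, or moves `E` into another eigenspace. The
  -- translates of `U'` span `V`, so `V = U' + X`, and the modular law with `E ∩ X = 0` gives `E ≤
  -- U'`.
  have hall : ∀ g, U'.map (ρ g) ≤ U' ⊔ X := by
    intro g
    obtain ⟨t, ht⟩ := hx g s
    by_cases hts : t = s
    · subst hts
      refine le_sup_of_le_left ?_
      rintro _ ⟨_, ⟨u, hu, rfl⟩, rfl⟩
      exact ⟨_, hU ⟨g, ht⟩ u hu, rfl⟩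
    · refine le_sup_of_le_right ?_
      rintro _ ⟨u, hu, rfl⟩
      exact Submodule.mem_iSup_of_mem (p := fun t : {t : K // t ≠ s} => End.eigenspace (ρ x) t.1)
        ⟨t, hts⟩ (ht u (hU'E hu))
  have htop : (⨆ g, U'.map (ρ g)) = ⊤ := by
    refine (hρ.2 _ ?_).resolve_left ?_
    · intro g v hv
      have : (⨆ h, U'.map (ρ h)) ≤ (⨆ h, U'.map (ρ h)).comap (ρ g) := by
        refine iSup_le fun h => ?_
        rintro _ ⟨u, hu, rfl⟩
        rw [Submodule.mem_comap, ← Module.End.mul_apply, ← map_mul]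
        exact Submodule.mem_iSup_of_mem (g * h) ⟨u, hu, rfl⟩
      exact this hv
    · intro h0
      apply hUb
      have h1 : U'.map (ρ 1) ≤ ⊥ := h0 ▸ le_iSup (fun g => U'.map (ρ g)) 1
      rw [map_one, Module.End.one_eq_id, Submodule.map_id, le_bot_iff] at h1
      exact Submodule.map_injective_of_injective (Submodule.injective_subtype E)
        (h1.trans (Submodule.map_bot _).symm)
  have h2 : U' ⊔ X = ⊤ := top_le_iff.mp (htop ▸ iSup_le hall)
  have h3 : E ≤ U' := by
    have := sup_inf_assoc_of_le X hU'E
    rw [h2, top_inf_eq, inf_comm, hdisj.eq_bot, sup_bot_eq] at this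
    exact this.le
  rw [eq_top_iff]
  intro v _
  obtain ⟨u, hu, huv⟩ := h3 v.2
  have : u = v := Subtype.ext huv
  exact this ▸ hu

/-- An endomorphism `f` commutes with `ρ x`, so it preserves the eigenspace and is some scalar `t`
there. The kernel of `f - t` is then a nonzero subrepresentation, hence everything. -/
theorem HasScalarEnds.of_stabilizerRep (ρ : Representation K G V) (hρ : ρ.IsIrreducible) (x : G)
    (s : K) (hs : End.eigenspace (ρ x) s ≠ ⊥)
    (h : HasScalarEnds (stabilizerRep ρ (End.eigenspace (ρ x) s))) : HasScalarEnds ρ := by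
  rw [Representation.isIrreducible_iff_forall] at hρ
  intro f hf
  have hfE : ∀ v ∈ End.eigenspace (ρ x) s, f v ∈ End.eigenspace (ρ x) s := by
    intro v hv
    rw [Module.End.mem_eigenspace_iff] at hv ⊢
    rw [← hf, hv, map_smul]
  obtain ⟨t, ht⟩ := h (f.restrict hfE) (fun g v => Subtype.ext (hf g.1 v.1))
  refine ⟨t, ?_⟩
  have := hρ.2 (LinearMap.ker (f - t • LinearMap.id)) (fun g v hv => by
    simp only [LinearMap.mem_ker, LinearMap.sub_apply, LinearMap.smul_apply, LinearMap.id_apply,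
      sub_eq_zero] at hv ⊢
    rw [hf, hv, map_smul])
  rcases this with h0 | h0
  · exfalso
    apply hs
    rw [eq_bot_iff, ← h0]
    intro v hv
    have := congrArg Subtype.val (ht ⟨v, hv⟩)
    simpa [sub_eq_zero] using this
  · intro v
    have : v ∈ LinearMap.ker (f - t • LinearMap.id) := h0 ▸ Submodule.mem_top
    simpa [sub_eq_zero] using this

theorem HasScalarEnds.of_forall_scalar {G : Type*} [Group G] (ρ : Representation K G V)
    (hρ : ρ.IsIrreducible) (h : ∀ g, ∃ s : K, ∀ v, ρ g v = s • v) : HasScalarEnds ρ := by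
  rw [Representation.isIrreducible_iff_forall] at hρ
  obtain ⟨hV, hρ⟩ := hρ
  obtain ⟨w, hw⟩ := exists_ne (0 : V)
  have := (hρ (K ∙ w) (fun g v hv => by
    obtain ⟨s, hs⟩ := h g
    rw [hs]
    exact Submodule.smul_mem _ _ hv)).resolve_left (by simpa using hw)
  intro f _
  have h1 : ∀ v, ∃ a : K, a • w = v := fun v =>
    Submodule.mem_span_singleton.mp (this ▸ Submodule.mem_top)
  obtain ⟨s, hs⟩ := h1 (f w)
  refine ⟨s, fun v => ?_⟩
  obtain ⟨a, rfl⟩ := h1 v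
  rw [map_smul, ← hs, smul_comm]

/-- Groups with a cyclic normal subgroup whose quotient is a `p`-group. -/
def IsQuasiElementary (p : ℕ) (G : Type*) [Group G] : Prop :=
  ∃ C : Subgroup G, C.Normal ∧ IsCyclic C ∧ ∀ g : G, ∃ k : ℕ, g ^ p ^ k ∈ C

theorem IsQuasiElementary.subgroup {p : ℕ} {G : Type*} [Group G] (h : IsQuasiElementary p G) (T : Subgroup G) :
    IsQuasiElementary p T := by
  obtain ⟨C, hC, hcyc, hp⟩ := h
  refine ⟨C.subgroupOf T, inferInstance, ?_, fun g => ?_⟩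
  · have hinj : Function.Injective ((T.subtype.comp (C.subgroupOf T).subtype).codRestrict C
        (fun x => x.2)) := by
      intro a b hab
      apply Subtype.ext
      apply Subtype.ext
      exact (congrArg Subtype.val hab :)
    exact isCyclic_of_injective _ hinj
  · obtain ⟨k, hk⟩ := hp g
    exact ⟨k, by simpa [Subgroup.mem_subgroupOf] using hk⟩

/-- The elements acting by operators that commute with the representation. -/
def centralKernel {G : Type*} [Group G] (ρ : Representation K G V) : Subgroup G where
  carrier := {x | ∀ g, ρ (x * g) = ρ (g * x)}
  one_mem' := by simp
  mul_mem' := by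
    intro a b ha hb g
    rw [mul_assoc, map_mul, hb, ← map_mul, ← mul_assoc, map_mul, ha, ← map_mul, mul_assoc]
  inv_mem' := by
    intro a ha g
    have := ha (a⁻¹ * g * a⁻¹)
    have h1 : a * (a⁻¹ * g * a⁻¹) = g * a⁻¹ := by group
    have h2 : a⁻¹ * g * a⁻¹ * a = a⁻¹ * g := by group
    rw [h1, h2] at this
    exact this.symm

instance centralKernel_normal {G : Type*} [Group G] (ρ : Representation K G V) :
    (centralKernel ρ).Normal where
  conj_mem := by
    intro x hx g h
    have key : ρ (g * x * g⁻¹) = ρ x := by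
      rw [mul_assoc, map_mul, hx g⁻¹, ← map_mul]
      simp
    rw [map_mul, key, ← map_mul, hx, map_mul, ← key, ← map_mul]

/-- The inductive step. In a counterexample, every element whose eigenspaces are permuted by the
group acts by a scalar. This applies to a generator of the cyclic normal subgroup, and then to any
element that is central modulo the scalars; since the quotient by the scalars is a `p`-group, the
whole group acts by scalars. -/
theorem hasScalarEnds_of_isQuasiElementary_aux {p : ℕ} [Fact p.Prime] {e : ℕ} [NeZero e]
    [HasEnoughRootsOfUnity K e] [FiniteDimensional K V]
    (hp : IsQuasiElementary p G) (hG : ∀ g : G, g ^ e = 1)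
    (ρ : Representation K G V) (hρ : ρ.IsIrreducible)
    (ih : ∀ (x : G) (s : K), End.eigenspace (ρ x) s ≠ ⊤ →
      (stabilizerRep ρ (End.eigenspace (ρ x) s)).IsIrreducible →
      HasScalarEnds (stabilizerRep ρ (End.eigenspace (ρ x) s))) : HasScalarEnds ρ := by
  by_contra hcon
  have hV := ((Representation.isIrreducible_iff_forall ρ).mp hρ).1
  have hscalar : ∀ x : G, (∀ (g : G) (s : K), ∃ t : K,
      ∀ v ∈ End.eigenspace (ρ x) s, ρ g v ∈ End.eigenspace (ρ x) t) → ∃ s : K, ∀ v, ρ x v = s • v := by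
    intro x hx
    by_contra hns
    obtain ⟨s, hs⟩ := exists_eigenspace_ne_bot (e := e) (ρ x) (by rw [← map_pow, hG, map_one])
    refine hcon (HasScalarEnds.of_stabilizerRep ρ hρ x s hs (ih x s (fun ht => hns ⟨s, ?_⟩)
      (stabilizerRep_isIrreducible ρ hρ x hx s hs)))
    intro v
    exact Module.End.mem_eigenspace_iff.mp (ht ▸ Submodule.mem_top)
  have hker : ∀ x ∈ centralKernel ρ, ∃ s : K, ∀ v, ρ x v = s • v := by
    intro x hx
    refine hscalar x fun g s => ⟨s, fun v hv => ?_⟩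
    rw [Module.End.mem_eigenspace_iff] at hv ⊢
    rw [← Module.End.mul_apply, ← map_mul, hx, map_mul, Module.End.mul_apply, hv, map_smul]
  have hker' : ∀ x, (∃ s : K, ∀ v, ρ x v = s • v) → x ∈ centralKernel ρ := by
    rintro x ⟨s, hs⟩ g
    ext v
    simp [hs]
  obtain ⟨C, hC, hcyc, hCp⟩ := hp
  obtain ⟨⟨c, hcC⟩, hc⟩ := hcyc.exists_generator
  have hCz : C ≤ centralKernel ρ := by
    have hcz : c ∈ centralKernel ρ := by
      refine hker' c (hscalar c fun g s => ?_)
      have hmem : g⁻¹ * c * g ∈ C := by simpa using hC.conj_mem c hcC g⁻¹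
      obtain ⟨n, hn⟩ := Subgroup.mem_zpowers_iff.mp (hc ⟨_, hmem⟩)
      have hn' : c ^ n = g⁻¹ * c * g := congrArg Subtype.val hn
      obtain ⟨m, hm⟩ : ∃ m : ℕ, c ^ m = g⁻¹ * c * g := by
        have : g⁻¹ * c * g ∈ Subgroup.zpowers c := ⟨n, hn'⟩
        obtain ⟨m, hm⟩ := mem_powers_iff_mem_zpowers.mpr this
        exact ⟨m, hm⟩
      -- As `c g = g c ^ m`, the operator `ρ g` maps the `s`-eigenspace of `c` into the `s ^
      -- m`-eigenspace.
      refine ⟨s ^ m, fun v hv => ?_⟩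
      rw [Module.End.mem_eigenspace_iff] at hv ⊢
      have h1 : c * g = g * c ^ m := by rw [hm]; group
      have h2 : ∀ m : ℕ, ρ (c ^ m) v = s ^ m • v := by
        intro m
        induction m with
        | zero => simp
        | succ m ih => rw [pow_succ, map_mul, Module.End.mul_apply, hv, map_smul, ih, smul_smul,
            pow_succ, mul_comm]
      rw [← Module.End.mul_apply, ← map_mul, h1, map_mul, Module.End.mul_apply, h2, map_smul]
    intro y hy
    obtain ⟨n, hn⟩ := Subgroup.mem_zpowers_iff.mp (hc ⟨y, hy⟩)
    have hn' : c ^ n = y := congrArg Subtype.val hn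
    exact hn' ▸ Subgroup.zpow_mem _ hcz n
  by_cases hZ : centralKernel ρ = ⊤
  · exact hcon (HasScalarEnds.of_forall_scalar ρ hρ fun g => hker g (hZ ▸ Subgroup.mem_top g))
  have hpg : IsPGroup p (G ⧸ centralKernel ρ) := by
    intro q
    induction q using QuotientGroup.induction_on with
    | H g =>
      obtain ⟨k, hk⟩ := hCp g
      refine ⟨k, ?_⟩
      rw [← QuotientGroup.mk_pow, QuotientGroup.eq_one_iff]
      exact hCz hk
  have : Nontrivial (G ⧸ centralKernel ρ) := QuotientGroup.nontrivial_iff.mpr hZ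
  -- Let `x` lift a nontrivial central element of the `p`-group. The commutator of `x` and `g` acts
  -- by a scalar `t`, so `ρ g` maps the `s`-eigenspace of `x` into the `s * t`-eigenspace.
  obtain ⟨⟨q, hq⟩, hq1⟩ := @exists_ne _ hpg.center_nontrivial 1
  induction q using QuotientGroup.induction_on with
  | H x =>
  have hxz : x ∉ centralKernel ρ := fun h =>
    hq1 (Subtype.ext ((QuotientGroup.eq_one_iff x).mpr h))
  refine hxz (hker' x (hscalar x fun g s => ?_))
  have hcomm : x⁻¹ * (g⁻¹ * x * g) ∈ centralKernel ρ := by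
    have := Subgroup.mem_center_iff.mp hq (g : G ⧸ centralKernel ρ)
    rw [← QuotientGroup.mk_mul, ← QuotientGroup.mk_mul, eq_comm, QuotientGroup.eq] at this
    have h2 : x⁻¹ * (g⁻¹ * x * g) = ((x * g)⁻¹ * (g * x))⁻¹ * (x⁻¹ * (g⁻¹ * x * g)) *
      1 * ((x * g)⁻¹ * (g * x)) := by group
    have h3 : g⁻¹ * ((x * g)⁻¹ * (g * x))⁻¹ * g = g⁻¹ * (x⁻¹ * (g⁻¹ * x * g)) * g := by group
    have h4 := (centralKernel_normal ρ).conj_mem _ (inv_mem this) (1 : G)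
    simpa [mul_assoc] using h4
  obtain ⟨t, ht⟩ := hker _ hcomm
  refine ⟨s * t, fun v hv => ?_⟩
  rw [Module.End.mem_eigenspace_iff] at hv ⊢
  have h1 : x * g = g * x * (x⁻¹ * (g⁻¹ * x * g)) := by group
  rw [← Module.End.mul_apply, ← map_mul, h1, map_mul, Module.End.mul_apply, ht, map_smul, map_mul,
    Module.End.mul_apply, hv, map_smul, smul_smul, mul_comm]

universe u w

theorem hasScalarEnds_of_isQuasiElementary {p : ℕ} [Fact p.Prime] {e : ℕ} [NeZero e]
    [HasEnoughRootsOfUnity K e] {G : Type u} [Group G] [Finite G] {V : Type w} [AddCommGroup V]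
    [Module K V] [FiniteDimensional K V] (hp : IsQuasiElementary p G) (hG : ∀ g : G, g ^ e = 1)
    (ρ : Representation K G V) (hρ : ρ.IsIrreducible) : HasScalarEnds ρ := by
  induction hn : finrank K V using Nat.strong_induction_on generalizing G V with
  | _ n ih =>
  refine hasScalarEnds_of_isQuasiElementary_aux (e := e) hp hG ρ hρ fun x s hE hirr => ?_
  refine ih _ ?_ (hp.subgroup _) (fun g => ?_) _ hirr rfl
  · rw [← hn]
    exact Submodule.finrank_lt hE
  · exact Subtype.ext (by simpa using hG g.1)

end Splitting

/-! ### Divisibility of dimensions of spaces of homomorphisms -/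

section HomDimensions

variable {K : Type*} [Field K]

theorem finrank_dvd_finrank_hom {R S X D : Type*} [Ring R] [Algebra K R] [AddCommGroup S]
    [Module R S] [AddCommGroup X] [Module R X] [Module K X] [IsScalarTower K R X]
    [DivisionRing D] [Algebra K D] (φ : D →ₐ[K] Module.End R X) :
    finrank K D ∣ finrank K (S →ₗ[R] X) := by
  let _ : Module D (S →ₗ[R] X) := Module.compHom (S →ₗ[R] X) φ.toRingHom
  have : IsScalarTower K D (S →ₗ[R] X) := ⟨fun k d f => by
    ext s
    change (φ (k • d)) (f s) = k • (φ d) (f s)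
    rw [map_smul]
    rfl⟩
  exact ⟨_, (Module.finrank_mul_finrank K D (S →ₗ[R] X)).symm⟩

/-- Composition with an isomorphism on the target, as an isomorphism over the ground field. -/
def homCongrRight {R S Y Z : Type*} [Ring R] [Algebra K R] [AddCommGroup S] [Module R S]
    [AddCommGroup Y] [Module R Y] [Module K Y] [IsScalarTower K R Y] [AddCommGroup Z] [Module R Z]
    [Module K Z] [IsScalarTower K R Z] (f : Y ≃ₗ[R] Z) : (S →ₗ[R] Y) ≃ₗ[K] (S →ₗ[R] Z) where
  toFun g := f.toLinearMap.comp g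
  invFun g := f.symm.toLinearMap.comp g
  map_add' g h := by ext; simp
  map_smul' c g := by
    ext s
    exact (f.toLinearMap.restrictScalars K).map_smul c (g s)
  left_inv g := by ext; simp
  right_inv g := by ext; simp

/-- Decompose `M` into simple modules. The isomorphism class of `S` contributes its multiplicity
times `dim Hom(S, X)`. As `S` has only scalar endomorphisms, the multiplicity is `dim Hom(S, M)`;
both factors are dimensions of vector spaces over `D`. -/
theorem sq_finrank_dvd_finrank_hom {R M X D : Type*} [Ring R] [Algebra K R] [AddCommGroup M]
    [Module R M] [Module K M] [IsScalarTower K R M] [FiniteDimensional K M] [IsSemisimpleModule R M]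
    [AddCommGroup X] [Module R X] [Module K X] [IsScalarTower K R X] [FiniteDimensional K X]
    [DivisionRing D] [Algebra K D] (φ : D →ₐ[K] Module.End R M) (ψ : D →ₐ[K] Module.End R X)
    (hM : ∀ S : Submodule R M, IsSimpleModule R S →
      ∀ f : S →ₗ[R] S, ∃ s : K, ∀ v, f v = s • v) :
    finrank K D ^ 2 ∣ finrank K (M →ₗ[R] X) := by
  classical
  have hfin : Module.Finite R M := Module.Finite.of_restrictScalars_finite K R M
  obtain ⟨n, S, e, hS⟩ := IsSemisimpleModule.exists_linearEquiv_fin_dfinsupp R M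
  let e' : M ≃ₗ[R] (∀ i, S i) := e.trans DFinsupp.linearEquivFunOnFintype
  have hfd : ∀ i, FiniteDimensional K (S i) := fun i =>
    inferInstanceAs (FiniteDimensional K ((S i).restrictScalars K))
  have hS1 : ∀ i, finrank K (S i →ₗ[R] S i) = 1 := by
    intro i
    have := hS i
    obtain ⟨w, hw⟩ := @exists_ne _ (IsSimpleModule.nontrivial R (S i)) 0
    refine finrank_eq_one LinearMap.id (fun h0 => hw (LinearMap.congr_fun h0 w)) fun f => ?_
    obtain ⟨s, hs⟩ := hM (S i) (hS i) f
    exact ⟨s, LinearMap.ext fun v => (hs v).symm⟩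
  have fdhom : ∀ (i : Fin n) {Y : Type _} [AddCommGroup Y] [Module R Y] [Module K Y]
      [IsScalarTower K R Y] [FiniteDimensional K Y], FiniteDimensional K (S i →ₗ[R] Y) := by
    intro i Y _ _ _ _ _
    exact FiniteDimensional.of_injective (LinearMap.restrictScalarsₗ K R (S i) Y K)
      (LinearMap.restrictScalars_injective K)
  have hX : finrank K (M →ₗ[R] X) = ∑ i, finrank K (S i →ₗ[R] X) := by
    have := fun i => fdhom i (Y := X)
    rw [← finrank_pi_fintype K]
    exact ((LinearEquiv.congrLeft X K e').trans
      (LinearMap.lsum R (fun i => S i) K).symm).finrank_eq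
  let r : Setoid (Fin n) :=
    { r := fun i j => Nonempty (S i ≃ₗ[R] S j)
      iseqv := ⟨fun _ => ⟨LinearEquiv.refl R _⟩, fun ⟨f⟩ => ⟨f.symm⟩,
        fun ⟨f⟩ ⟨g⟩ => ⟨f.trans g⟩⟩ }
  -- `Hom(S j, S i)` has dimension one or zero, according to whether `S i` and `S j` are isomorphic.
  have hcount : ∀ j, (Finset.univ.filter fun i => Quotient.mk r i = Quotient.mk r j).card =
      finrank K (S j →ₗ[R] M) := by
    intro j
    have h1 : finrank K (S j →ₗ[R] M) = ∑ i, finrank K (S j →ₗ[R] S i) := by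
      have : ∀ i, FiniteDimensional K (S j →ₗ[R] S i) := fun i =>
        FiniteDimensional.of_injective (LinearMap.restrictScalarsₗ K R (S j) (S i) K)
          (LinearMap.restrictScalars_injective K)
      rw [← finrank_pi_fintype K]
      exact ((homCongrRight e').trans (LinearEquiv.linearMapPi K).symm).finrank_eq
    rw [h1, Finset.card_filter]
    refine Finset.sum_congr rfl fun i _ => ?_
    split_ifs with h
    · obtain ⟨f⟩ := Quotient.exact h
      rw [← hS1 j]
      exact (homCongrRight f.symm).finrank_eq
    · have : Subsingleton (S j →ₗ[R] S i) := ⟨fun f g => by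
        have := hS i
        have := hS j
        have key : ∀ f : S j →ₗ[R] S i, f = 0 := fun f =>
          (LinearMap.bijective_or_eq_zero f).resolve_left fun hf =>
            h (Quotient.sound ⟨(LinearEquiv.ofBijective f hf).symm⟩)
        rw [key f, key g]⟩
      exact (finrank_zero_of_subsingleton).symm
  have hconst : ∀ i j, Quotient.mk r i = Quotient.mk r j →
      finrank K (S i →ₗ[R] X) = finrank K (S j →ₗ[R] X) := by
    intro i j h
    obtain ⟨f⟩ := Quotient.exact h
    exact (LinearEquiv.congrLeft X K f).finrank_eq
  rw [hX, ← Finset.sum_fiberwise Finset.univ (Quotient.mk r)]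
  refine Finset.dvd_sum fun q _ => ?_
  induction q using Quotient.inductionOn with
  | h j =>
    rw [Finset.sum_congr rfl fun i hi => hconst i j (Finset.mem_filter.mp hi).2,
      Finset.sum_const, hcount, smul_eq_mul, sq]
    exact mul_dvd_mul (finrank_dvd_finrank_hom φ) (finrank_dvd_finrank_hom ψ)

variable {G V : Type*} [Group G] [AddCommGroup V] [Module K V] [FiniteDimensional K V]

theorem finrank_intertwiningMap_eq_one {G V : Type*} [Group G] [AddCommGroup V] [Module K V]
    {ρ : Representation K G V} [Nontrivial V]
    (h : HasScalarEnds ρ) : finrank K (IntertwiningMap ρ ρ) = 1 := by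
  obtain ⟨w, hw⟩ := exists_ne (0 : V)
  refine finrank_eq_one (IntertwiningMap.id ρ) (fun h0 => hw ?_) fun f => ?_
  · have := congrArg (fun f : IntertwiningMap ρ ρ => f w) h0
    simpa using this
  · obtain ⟨s, hs⟩ := h f.toLinearMap (fun g v => IntertwiningMap.isIntertwining ρ ρ f g v)
    refine ⟨s, ?_⟩
    ext v
    exact (hs v).symm

theorem hasScalarEnds_of_finrank {G V : Type*} [Group G] [AddCommGroup V] [Module K V]
    {ρ : Representation K G V} [Nontrivial V]
    (h : finrank K (IntertwiningMap ρ ρ) = 1) : HasScalarEnds ρ := by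
  obtain ⟨w, hw⟩ := exists_ne (0 : V)
  have hid : IntertwiningMap.id ρ ≠ 0 := fun h0 => hw (by
    have := congrArg (fun f : IntertwiningMap ρ ρ => f w) h0
    simpa using this)
  intro f hf
  obtain ⟨s, hs⟩ := (finrank_eq_one_iff_of_nonzero' _ hid).mp h
    ⟨f, fun g => by ext v; exact hf g v⟩
  exact ⟨s, fun v => (congrArg (fun f : IntertwiningMap ρ ρ => f v) hs).symm⟩

/-- Tensoring an intertwining operator of a representation with another representation, after
pulling back to a group mapping to the original one. -/
noncomputable def rTensorIntertwining {H W : Type*} [Group H] [AddCommGroup W] [Module K W]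
    (ρ : Representation K G V) (π : Representation K H W) (i : H →* G) :
    IntertwiningMap ρ ρ →ₐ[K]
      IntertwiningMap (tprod (ρ.comp i) π) (tprod (ρ.comp i) π) :=
  AlgHom.ofLinearMap
    { toFun := fun f => ⟨f.toLinearMap.rTensor W, fun g => by
        ext v w
        simp [IntertwiningMap.isIntertwining ρ ρ f]⟩
      map_add' := fun f g => by
        apply IntertwiningMap.ext
        simp [LinearMap.rTensor_add]
      map_smul' := fun c f => by
        apply IntertwiningMap.ext
        exact LinearMap.rTensor_smul W c f.toLinearMap }
    (by
      apply IntertwiningMap.ext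
      exact LinearMap.rTensor_id W V)
    (fun f g => by
      apply IntertwiningMap.ext
      exact LinearMap.rTensor_comp W f.toLinearMap g.toLinearMap)

/-- Pulling back an intertwining operator along a group homomorphism. -/
def compIntertwining {H : Type*} [Group H] (ρ : Representation K G V) (i : H →* G) :
    IntertwiningMap ρ ρ →ₐ[K]
      IntertwiningMap (MonoidHom.comp ρ i : Representation K H V) (MonoidHom.comp ρ i) where
  toFun f := ⟨f.toLinearMap, fun g => by ext v; exact IntertwiningMap.isIntertwining ρ ρ f (i g) v⟩
  map_one' := rfl
  map_mul' _ _ := rfl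
  map_zero' := rfl
  map_add' _ _ := rfl
  commutes' _ := rfl

/-- By Schur's lemma `End_G(ρ)` is a division algebra. It acts on the pullback of `ρ` to `H`, and on
the tensor product through the first factor. The splitting hypothesis is needed only for subspaces
of `V`, where the simple constituents of the pullback live. -/
theorem sq_finrank_dvd_of_split [CharZero K] {H W : Type*} [Group H] [Finite H] [AddCommGroup W]
    [Module K W] [FiniteDimensional K W] (ρ : Representation K G V) [hρ : ρ.IsIrreducible]
    (π : Representation K H W) (i : H →* G)
    (hH : ∀ (U : Submodule K V) (τ : Representation K H U), τ.IsIrreducible → HasScalarEnds τ) :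
    finrank K (IntertwiningMap ρ ρ) ^ 2 ∣
      finrank K (IntertwiningMap (MonoidHom.comp ρ i : Representation K H V)
        (tprod (MonoidHom.comp ρ i) π)) := by
  classical
  set ρH : Representation K H V := MonoidHom.comp ρ i with hρH
  rw [(IntertwiningMap.equivAlgEnd ρ).toLinearEquiv.finrank_eq,
    (IntertwiningMap.equivLinearMapAsModule ρH (tprod ρH π)).finrank_eq]
  have : FiniteDimensional K ρH.asModule := inferInstanceAs (FiniteDimensional K V)
  have : FiniteDimensional K (tprod ρH π).asModule :=
    inferInstanceAs (FiniteDimensional K (TensorProduct K V W))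
  have : NeZero (Nat.card H : K) := ⟨Nat.cast_ne_zero.mpr Nat.card_pos.ne'⟩
  refine sq_finrank_dvd_finrank_hom
    (((IntertwiningMap.equivAlgEnd ρH).toAlgHom.comp (compIntertwining ρ i)).comp
      (IntertwiningMap.equivAlgEnd ρ).symm.toAlgHom)
    (((IntertwiningMap.equivAlgEnd (tprod ρH π)).toAlgHom.comp (rTensorIntertwining ρ π i)).comp
      (IntertwiningMap.equivAlgEnd ρ).symm.toAlgHom) fun S hS => ?_
  intro f
  set σ : Subrepresentation ρH := Subrepresentation.ofSubmodule' S with hσ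
  have hτ : σ.toRepresentation.IsIrreducible := by
    rw [Representation.isIrreducible_iff_forall]
    have hnt := IsSimpleModule.nontrivial (MonoidAlgebra K H) S
    refine ⟨hnt, fun U hU => ?_⟩
    let υ : Subrepresentation ρH := ⟨U.map σ.toSubmodule.subtype, by
      rintro g _ ⟨u, hu, rfl⟩
      exact ⟨_, hU g u hu, rfl⟩⟩
    have hle : υ.asSubmodule ≤ S := by
      rintro _ ⟨u, _, rfl⟩
      exact u.2
    rcases (isSimpleModule_iff_isAtom.mp hS).le_iff.mp hle with h | h
    · left
      rw [eq_bot_iff]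
      intro u hu
      have h1 : (u.1 : V) ∈ υ.toSubmodule := ⟨u, hu, rfl⟩
      exact Subtype.ext ((Submodule.mem_bot (MonoidAlgebra K H) (M := ρH.asModule)).mp (h.le h1))
    · right
      rw [eq_top_iff]
      intro u _
      have : (u.1 : V) ∈ υ.toSubmodule := h.ge u.2
      obtain ⟨w, hw, hwu⟩ := this
      have : w = u := Subtype.ext hwu
      exact this ▸ hw
  obtain ⟨s, hs⟩ := hH _ σ.toRepresentation hτ
    { toFun := fun u => f u
      map_add' := fun a b => f.map_add a b
      map_smul' := fun c a => (f.restrictScalars K).map_smul c a }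
    (fun g v => by
      have key : ∀ x : S, MonoidAlgebra.single g (1 : K) • x = σ.toRepresentation g x := by
        intro x
        apply Subtype.ext
        rw [Submodule.coe_smul, Representation.single_smul, one_smul]
        rfl
      exact (congrArg f (key v).symm).trans ((f.map_smul _ _).trans (key (f v))))
  exact ⟨s, hs⟩

end HomDimensions

/-! ### Fixed points on cosets of quasi-elementary subgroups -/

section QuasiElementarySubgroups

variable {G : Type*} [Group G] [Finite G]

/-- Let `C` be generated by the `p'`-part of `g`, let `M` be its normalizer, and choose `H/C` to be
a Sylow `p`-subgroup of `M/C` containing the image of `g`. The cosets fixed by `C` form the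
`M`-orbit of the base point, of size `|M : H|` prime to `p`. On this orbit `g` has the same fixed
points as its power `g ^ m` of `p`-power order, whose number is congruent to `|M : H|` modulo `p`.
-/
theorem exists_isQuasiElementary_not_dvd (p : ℕ) [hp : Fact p.Prime] (g : G) :
    ∃ H : Subgroup G, IsQuasiElementary p H ∧ ¬ p ∣ Nat.card {q : G ⧸ H // g • q = q} := by
  classical
  obtain ⟨a, m, hm, hord⟩ := Nat.exists_eq_pow_mul_and_not_dvd (orderOf_pos g).ne' p hp.out.ne_one
  have hcop : Nat.Coprime (p ^ a) m :=
    Nat.Coprime.pow_left _ ((Nat.Prime.coprime_iff_not_dvd hp.out).mpr hm)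
  set c := g ^ p ^ a with hc
  have hcord : c ^ m = 1 := by rw [hc, ← pow_mul, ← hord, pow_orderOf_eq_one]
  set C := Subgroup.zpowers c with hC
  set M := Subgroup.normalizer (C : Set G) with hM
  have hCM : C ≤ M := Subgroup.le_normalizer
  have hgM : g ∈ M := by
    refine Subgroup.mem_normalizer_iff.mpr fun x => ?_
    have hcomm : ∀ x ∈ C, g * x * g⁻¹ = x := by
      intro x hx
      obtain ⟨n, rfl⟩ := hx
      have : Commute g (c ^ n) := ((Commute.refl g).pow_right _).zpow_right _
      simp only [this.eq, mul_inv_cancel_right]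
    refine ⟨fun hx => (hcomm x hx).symm ▸ hx, fun hx => ?_⟩
    have h1 := hcomm _ hx
    have : x = g * x * g⁻¹ := by
      have h2 : g * (g * x * g⁻¹) * g⁻¹ = g * x * g⁻¹ := h1
      have h3 := mul_right_cancel h2
      exact (mul_left_cancel h3).symm
    exact this.symm ▸ hx
  let C' := C.subgroupOf M
  have : C'.Normal := Subgroup.normal_in_normalizer
  let gM : M := ⟨g, hgM⟩
  have hpz : IsPGroup p (Subgroup.zpowers (gM : M ⧸ C')) := by
    rintro ⟨_, n, rfl⟩
    refine ⟨a, Subtype.ext ?_⟩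
    have h1 : (gM : M ⧸ C') ^ p ^ a = 1 := by
      rw [← QuotientGroup.mk_pow, QuotientGroup.eq_one_iff, Subgroup.mem_subgroupOf]
      exact Subgroup.mem_zpowers c
    change (((gM : M ⧸ C') ^ n)) ^ p ^ a = 1
    rw [← zpow_natCast, zpow_comm, zpow_natCast, h1, one_zpow]
  obtain ⟨P, hP⟩ := hpz.exists_le_sylow
  let H' : Subgroup M := (P : Subgroup (M ⧸ C')).comap (QuotientGroup.mk' C')
  let H : Subgroup G := H'.map M.subtype
  have hHM : H ≤ M := Subgroup.map_subtype_le H'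
  have hmemH : ∀ x : M, (x : G) ∈ H ↔ x ∈ H' := fun x => by
    simp [H]
  have hCH : C ≤ H := by
    intro x hx
    refine (hmemH ⟨x, hCM hx⟩).mpr ?_
    have h1 : QuotientGroup.mk' C' ⟨x, hCM hx⟩ = 1 :=
      (QuotientGroup.eq_one_iff (N := C') (⟨x, hCM hx⟩ : M)).mpr hx
    rw [Subgroup.mem_comap, h1]
    exact one_mem _
  have hpH : ∀ x ∈ H, ∃ k : ℕ, x ^ p ^ k ∈ C := by
    intro x hx
    have hx' := (hmemH ⟨x, hHM hx⟩).mp hx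
    obtain ⟨k, hk⟩ := P.2 ⟨_, hx'⟩
    refine ⟨k, ?_⟩
    have := congrArg Subtype.val hk
    exact (QuotientGroup.eq_one_iff (N := C') ((⟨x, hHM hx⟩ : M) ^ p ^ k)).mp this
  have hgH : g ∈ H := (hmemH gM).mpr (hP (Subgroup.mem_zpowers _))
  -- Some `p`-power of `x` lies in `C`, and `x` is a power of it because its order is prime to `p`.
  have hp'H : ∀ x ∈ H, x ^ m = 1 → x ∈ C := by
    intro x hx hxm
    obtain ⟨k, hk⟩ := hpH x hx
    have hcop' : Nat.Coprime (p ^ k) m :=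
      Nat.Coprime.pow_left _ ((Nat.Prime.coprime_iff_not_dvd hp.out).mpr hm)
    have h1 := Int.gcd_eq_gcd_ab (p ^ k : ℕ) m
    rw [Int.gcd_natCast_natCast, hcop'] at h1
    have h2 : x = (x ^ p ^ k) ^ (Int.gcdA (p ^ k : ℕ) m) := by
      rw [← zpow_natCast, ← zpow_mul]
      conv_lhs => rw [← zpow_one x]
      have : (1 : ℤ) = ((p ^ k : ℕ) : ℤ) * Int.gcdA (p ^ k : ℕ) m
        + m * Int.gcdB (p ^ k : ℕ) m := by exact_mod_cast h1
      rw [this, zpow_add, zpow_mul x m, zpow_natCast x m, hxm, one_zpow, mul_one]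
    rw [h2]
    exact Subgroup.zpow_mem _ hk _
  refine ⟨H, ⟨C.subgroupOf H, ?_, ?_, ?_⟩, ?_⟩
  · refine ⟨fun x hx y => ?_⟩
    have := (Subgroup.mem_normalizer_iff.mp (hHM y.2) x).mp hx
    exact this
  · exact (Subgroup.subgroupOfEquivOfLe hCH).isCyclic.mpr inferInstance
  · intro x
    obtain ⟨k, hk⟩ := hpH x x.2
    exact ⟨k, hk⟩
  -- counting fixed points
  let x₀ : G ⧸ H := ((1 : G) : G ⧸ H)
  have horb : ∀ q : G ⧸ H, c • q = q → q ∈ MulAction.orbit M x₀ := by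
    intro q hq
    induction q using QuotientGroup.induction_on with
    | H x =>
    have h1 : x⁻¹ * c * x ∈ H := by
      have : ((c * x : G) : G ⧸ H) = x := hq
      have := QuotientGroup.eq.mp this.symm
      simpa [mul_assoc] using this
    have h2 : x⁻¹ * c * x ∈ C := hp'H _ h1 (by
      have := conj_pow (a := x⁻¹) (b := c) (i := m)
      rw [inv_inv] at this
      rw [this, hcord]
      group)
    -- A coset `x H` fixed by `c` has `x⁻¹ c x` in `C`, so `x` normalizes `C`.
    have h3 : ∀ y ∈ C, x⁻¹ * y * x⁻¹⁻¹ ∈ C := by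
      rintro _ ⟨n, rfl⟩
      have := Subgroup.zpow_mem C h2 n
      have h4 := conj_zpow (a := x⁻¹) (b := c) (i := n)
      rw [inv_inv] at h4 ⊢
      rwa [h4] at this
    have hx : x⁻¹ ∈ M := Subgroup.mem_normalizer_fintype h3
    exact ⟨⟨x, (inv_mem_iff (H := M)).mp hx⟩, by
      change ((x * 1 : G) : G ⧸ H) = x
      rw [mul_one]⟩
  have hcfix : ∀ q ∈ MulAction.orbit M x₀, c • q = q := by
    rintro _ ⟨x, rfl⟩
    change ((c * (x.1 * 1) : G) : G ⧸ H) = ((x.1 * 1 : G) : G ⧸ H)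
    rw [eq_comm, QuotientGroup.eq, mul_one]
    apply hCH
    have := (Subgroup.mem_normalizer_iff.mp (inv_mem x.2) c).mp (Subgroup.mem_zpowers c)
    simpa [mul_assoc] using this
  have hstab : MulAction.stabilizer M x₀ = H' := by
    ext x
    rw [MulAction.mem_stabilizer_iff, ← hmemH]
    change ((x.1 * 1 : G) : G ⧸ H) = ((1 : G) : G ⧸ H) ↔ _
    rw [eq_comm, QuotientGroup.eq]
    simp
  have hcard : ¬ p ∣ Nat.card (MulAction.orbit M x₀) := by
    have h1 := MulAction.index_stabilizer M x₀
    rw [hstab, Subgroup.index_comap_of_surjective _ (QuotientGroup.mk'_surjective C')] at h1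
    have := P.not_dvd_index
    rw [h1] at this
    rwa [Nat.card_coe_set_eq]
  have hpγ : IsPGroup p (Subgroup.zpowers (gM ^ m)) := by
    rintro ⟨_, n, rfl⟩
    refine ⟨a, Subtype.ext ?_⟩
    have h1 : (gM ^ m) ^ p ^ a = 1 := by
      apply Subtype.ext
      change (g ^ m) ^ p ^ a = 1
      rw [← pow_mul, mul_comm, ← hord, pow_orderOf_eq_one]
    change ((gM ^ m) ^ n) ^ p ^ a = 1
    rw [← zpow_natCast, zpow_comm, zpow_natCast, h1, one_zpow]
  have hmod := hpγ.card_modEq_card_fixedPoints (MulAction.orbit M x₀)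
  have hfix : Nat.card {q : G ⧸ H // g • q = q} =
      Nat.card (MulAction.fixedPoints (Subgroup.zpowers (gM ^ m)) (MulAction.orbit M x₀)) := by
    have hpow : ∀ (n : ℕ) (q : G ⧸ H), g • q = q → g ^ n • q = q := by
      intro n q hq
      induction n with
      | zero => simp
      | succ n ih => rw [pow_succ, mul_smul, hq, ih]
    refine Nat.card_congr
      { toFun := fun q => ⟨⟨q.1, horb q.1 (hpow _ _ q.2)⟩, ?_⟩
        invFun := fun q => ⟨q.1.1, ?_⟩
        left_inv := fun _ => rfl
        right_inv := fun _ => rfl }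
    · rintro ⟨γ, hγ⟩
      have h1 : gM ^ m ∈ MulAction.stabilizer M q.1 := hpow m q.1 q.2
      have h2 : γ ∈ MulAction.stabilizer M q.1 := (Subgroup.zpowers_le.mpr h1) hγ
      exact Subtype.ext h2
    · have h1 : g ^ m ∈ MulAction.stabilizer G q.1.1 :=
        congrArg Subtype.val (q.2 ⟨gM ^ m, Subgroup.mem_zpowers _⟩)
      have h2 : g ^ p ^ a ∈ MulAction.stabilizer G q.1.1 := hcfix q.1.1 q.1.2
      have h3 := Int.gcd_eq_gcd_ab (p ^ a : ℕ) m
      rw [Int.gcd_natCast_natCast, hcop] at h3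
      -- Since `p ^ a` and `m` are coprime, a point fixed by `g ^ p ^ a` and by `g ^ m` is fixed by
      -- `g`.
      have h4 : g = (g ^ p ^ a) ^ (Int.gcdA (p ^ a : ℕ) m) * (g ^ m) ^ (Int.gcdB (p ^ a : ℕ) m) := by
        rw [← zpow_natCast, ← zpow_mul, ← zpow_natCast, ← zpow_mul, ← zpow_add, ← h3]
        simp
      have h5 : g ∈ MulAction.stabilizer G q.1.1 := by
        rw [h4]
        exact mul_mem (zpow_mem h2 _) (zpow_mem h1 _)
      exact h5
  rw [hfix]
  intro hdvd
  exact hcard ((Nat.modEq_zero_iff_dvd).mp (hmod.trans ((Nat.modEq_zero_iff_dvd).mpr hdvd)))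

end QuasiElementarySubgroups

/-! ### Brauer's splitting theorem -/

section BrauerSplitting

variable {K : Type*} [Field K]

/-- The number of fixed points of `g`. -/
noncomputable def fixedCount {G : Type*} (Y : Type*) [Group G] [MulAction G Y] (g : G) : ℕ :=
  Nat.card {y : Y // g • y = y}

theorem fixedCount_prod {G Y Z : Type*} [Group G] [MulAction G Y] [MulAction G Z] (g : G) :
    fixedCount (Y × Z) g = fixedCount Y g * fixedCount Z g := by
  rw [fixedCount, fixedCount, fixedCount, ← Nat.card_prod]
  exact Nat.card_congr
    { toFun := fun y => (⟨y.1.1, congrArg Prod.fst y.2⟩, ⟨y.1.2, congrArg Prod.snd y.2⟩)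
      invFun := fun y => ⟨(y.1.1, y.2.1), Prod.ext y.1.2 y.2.2⟩
      left_inv := fun _ => rfl
      right_inv := fun _ => rfl }

theorem fixedCount_conj {G Y : Type*} [Group G] [MulAction G Y] (g x : G) :
    fixedCount Y (x * g * x⁻¹) = fixedCount Y g := by
  refine Nat.card_congr
    { toFun := fun y => ⟨x⁻¹ • y.1, ?_⟩
      invFun := fun y => ⟨x • y.1, ?_⟩
      left_inv := fun _ => Subtype.ext (smul_inv_smul _ _)
      right_inv := fun _ => Subtype.ext (inv_smul_smul _ _) }
  · have := y.2
    rw [mul_smul, mul_smul] at this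
    rw [eq_inv_smul_iff, this]
  · rw [mul_smul, mul_smul, inv_smul_smul, y.2]

/-- The permutation representation on functions on a `G`-set. -/
def permRep (K : Type*) [Field K] (G Y : Type*) [Group G] [MulAction G Y] :
    Representation K G (Y → K) where
  toFun g := LinearMap.funLeft K K (fun y => g⁻¹ • y)
  map_one' := by ext; simp [LinearMap.funLeft]
  map_mul' g h := by
    ext
    simp [LinearMap.funLeft_apply, mul_smul]

theorem character_permRep (G Y : Type*) [Group G] [MulAction G Y] [Finite Y] (g : G) :
    (permRep K G Y).character g = fixedCount Y g := by
  classical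
  have := Fintype.ofFinite Y
  rw [Representation.character, LinearMap.trace_eq_matrix_trace K (Pi.basisFun K Y), Matrix.trace,
    fixedCount, Nat.card_eq_fintype_card, Fintype.card_subtype, Finset.card_filter, Nat.cast_sum]
  refine Finset.sum_congr rfl fun y _ => ?_
  rw [Matrix.diag_apply, LinearMap.toMatrix_apply]
  have h : g⁻¹ • y = y ↔ g • y = y := by rw [inv_smul_eq_iff, eq_comm]
  simp [permRep, LinearMap.funLeft_apply, Pi.single_apply, h]

/-- Frobenius reciprocity for the permutation character on `G ⧸ H`: the coset `x H` contributes the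
sum of `F` over its stabilizer `x H x⁻¹`, which is the sum over `H`. -/
theorem sum_fixedCount_mul {G : Type*} [Group G] [Fintype G] (H : Subgroup G) [Fintype H]
    (F : G → K) (hF : ∀ g x, F (x * g * x⁻¹) = F g) :
    (Nat.card H : K) * ∑ g, (fixedCount (G ⧸ H) g : K) * F g = Nat.card G * ∑ h : H, F h := by
  classical
  have := Fintype.ofFinite (G ⧸ H)
  have h1 : ∀ q : G ⧸ H, ∑ g : G, (if g • q = q then F g else 0) = ∑ h : H, F h := by
    intro q
    induction q using QuotientGroup.induction_on with
    | H x =>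
    have h2 : ∀ g : G, g • (x : G ⧸ H) = x ↔ x⁻¹ * g * x ∈ H := by
      intro g
      change ((g * x : G) : G ⧸ H) = x ↔ _
      rw [eq_comm, QuotientGroup.eq, mul_assoc]
    simp_rw [h2]
    rw [← Equiv.sum_comp (MulAut.conj x).toEquiv]
    have h3 : ∀ g : G, (if x⁻¹ * (MulAut.conj x).toEquiv g * x ∈ H then
        F ((MulAut.conj x).toEquiv g) else 0) = if g ∈ H then F g else 0 := by
      intro g
      have : x⁻¹ * (MulAut.conj x).toEquiv g * x = g := by
        simp [mul_assoc]
      rw [this]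
      simp [hF]
    simp_rw [h3]
    rw [← Finset.sum_filter]
    exact (Finset.sum_subtype _ (by simp) F)
  have h4 : ∀ g : G, (fixedCount (G ⧸ H) g : K) * F g =
      ∑ q : G ⧸ H, if g • q = q then F g else 0 := by
    intro g
    rw [fixedCount, Nat.card_eq_fintype_card, Fintype.card_subtype, ← Finset.sum_filter,
      Finset.sum_const, nsmul_eq_mul]
  simp_rw [h4]
  rw [Finset.sum_comm]
  simp_rw [h1]
  rw [Finset.sum_const, nsmul_eq_mul, ← mul_assoc, Finset.card_univ, ← Nat.card_eq_fintype_card,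
    ← Nat.cast_mul, mul_comm (Nat.card H), ← Subgroup.card_eq_card_quotient_mul_card_subgroup]

universe u

variable [CharZero K]

theorem sum_char_mul_fixedCount {H V Y : Type*} [Group H] [Fintype H] [AddCommGroup V] [Module K V]
    [FiniteDimensional K V] [MulAction H Y] [Finite Y] (ρ : Representation K H V) :
    ∑ h, (fixedCount Y h : K) * (ρ.character h * ρ.character h⁻¹) =
      Nat.card H * finrank K (IntertwiningMap ρ (tprod ρ (permRep K H Y))) := by
  have := Fintype.ofFinite Y
  have h0 : (Nat.card H : K) ≠ 0 := Nat.cast_ne_zero.mpr Nat.card_pos.ne'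
  have := invertibleOfNonzero h0
  rw [← card_inv_mul_sum_char_mul_char_eq_finrank, ← mul_assoc, mul_inv_cancel₀ h0, one_mul]
  refine Finset.sum_congr rfl fun h _ => ?_
  rw [char_tensor, Pi.mul_apply, character_permRep]
  ring

/-- With χ the character and `d = ⟨χ, χ⟩`, some integer `n` prime to `p` is built from permutation
characters on cosets of `p`-quasi-elementary subgroups by products and integral combinations. Over
such subgroups everything splits, so `d ^ 2` divides `⟨n χ, χ⟩ = n d`; hence `d` divides `n`. -/
theorem not_dvd_finrank_intertwiningMap {G : Type u} [Group G] [Finite G] {V : Type*}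
    [AddCommGroup V] [Module K V] [FiniteDimensional K V] {e : ℕ} [NeZero e]
    [HasEnoughRootsOfUnity K e] (hG : ∀ g : G, g ^ e = 1) (ρ : Representation K G V)
    (hρ : ρ.IsIrreducible) (p : ℕ) [hp : Fact p.Prime] :
    ¬ p ∣ finrank K (IntertwiningMap ρ ρ) := by
  classical
  have := Fintype.ofFinite G
  set d := finrank K (IntertwiningMap ρ ρ) with hd
  have hV := ((Representation.isIrreducible_iff_forall ρ).mp hρ).1
  have hd0 : d ≠ 0 := by
    have : Nontrivial (IntertwiningMap ρ ρ) := by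
      obtain ⟨w, hw⟩ := exists_ne (0 : V)
      refine ⟨IntertwiningMap.id ρ, 0, fun h0 => hw ?_⟩
      have := congrArg (fun f : IntertwiningMap ρ ρ => f w) h0
      simpa using this
    exact (finrank_pos).ne'
  let F : G → K := fun g => ρ.character g * ρ.character g⁻¹
  -- the functions `f` for which `⟨f π χ, χ⟩` is divisible by `d²` for all permutation characters `π`
  let T : (G → ℤ) → Prop := fun f => ∀ (Y : Type u) [MulAction G Y] [Finite Y], ∃ z : ℤ,
    ∑ g, (f g : K) * ((fixedCount Y g : K) * F g) = Nat.card G * ((d ^ 2 : ℕ) * z)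
  have hTadd : ∀ f f', T f → T f' → T (f + f') := by
    intro f f' hf hf' Y _ _
    obtain ⟨z, hz⟩ := hf Y
    obtain ⟨z', hz'⟩ := hf' Y
    refine ⟨z + z', ?_⟩
    simp only [Pi.add_apply, Int.cast_add, add_mul, Finset.sum_add_distrib, hz, hz']
    ring
  have hTsmul : ∀ (n : ℤ) f, T f → T (fun g => n * f g) := by
    intro n f hf Y _ _
    obtain ⟨z, hz⟩ := hf Y
    refine ⟨n * z, ?_⟩
    simp only [Int.cast_mul, mul_assoc, ← Finset.mul_sum, hz]
    ring
  have hTmul : ∀ (Z : Type u) [MulAction G Z] [Finite Z] f, T f →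
      T (fun g => fixedCount Z g * f g) := by
    intro Z _ _ f hf Y _ _
    obtain ⟨z, hz⟩ := hf (Z × Y)
    refine ⟨z, ?_⟩
    rw [← hz]
    refine Finset.sum_congr rfl fun g _ => ?_
    rw [fixedCount_prod]
    push_cast
    ring
  have hTH : ∀ H : Subgroup G, IsQuasiElementary p H → T (fun g => fixedCount (G ⧸ H) g) := by
    intro H hH Y _ _
    have hdvd := sq_finrank_dvd_of_split ρ (permRep K H Y) H.subtype (fun U τ hτ =>
      hasScalarEnds_of_isQuasiElementary (e := e) hH (fun h => Subtype.ext (hG h)) τ hτ)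
    obtain ⟨z, hz⟩ := hdvd
    refine ⟨z, ?_⟩
    have hH0 : (Nat.card H : K) ≠ 0 := Nat.cast_ne_zero.mpr Nat.card_pos.ne'
    have h1 := sum_char_mul_fixedCount (Y := Y) (MonoidHom.comp ρ H.subtype : Representation K H V)
    have h2 := sum_fixedCount_mul H (fun g => (fixedCount Y g : K) * F g) (fun g x => by
      have h3 : F (x * g * x⁻¹) = F g := by
        change ρ.character (x * g * x⁻¹) * ρ.character (x * g * x⁻¹)⁻¹ = _
        have : (x * g * x⁻¹)⁻¹ = x * g⁻¹ * x⁻¹ := by group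
        rw [this, char_conj, char_conj]
      rw [h3, fixedCount_conj])
    have h4 : ∑ h : H, (fixedCount Y (h : G) : K) * F h =
        Nat.card H * ((d ^ 2 * z : ℕ) : K) := by
      rw [← hz, ← h1]
      rfl
    rw [h4] at h2
    apply mul_left_cancel₀ hH0
    push_cast at h2 ⊢
    rw [h2]
    ring
  choose H hHq hHn using fun g : G => exists_isQuasiElementary_not_dvd p g
  let m : G → ℤ := fun g => fixedCount (G ⧸ H g) g
  -- Expand the product: every term except the constant one involves a permutation character on some
  -- `G ⧸ H s`, so it satisfies `T`.
  have hprod : ∀ S : Finset G, ∃ t : G → ℤ, T t ∧ ∀ g,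
      ∏ s ∈ S, ((fixedCount (G ⧸ H s) g : ℤ) - m s) = t g + ∏ s ∈ S, (- m s) := by
    intro S
    induction S using Finset.induction_on with
    | empty => exact ⟨0, fun Y _ _ => ⟨0, by simp⟩, fun g => by simp⟩
    | insert s S hs ih =>
      obtain ⟨t, ht, htS⟩ := ih
      refine ⟨(fun g => fixedCount (G ⧸ H s) g * t g) + ((fun g => (- m s) * t g) +
        (fun g => (∏ s ∈ S, (- m s)) * fixedCount (G ⧸ H s) g)),
        hTadd _ _ (hTmul _ _ ht) (hTadd _ _ (hTsmul _ _ ht) (hTsmul _ _ (hTH _ (hHq s)))),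
        fun g => ?_⟩
      rw [Finset.prod_insert hs, Finset.prod_insert hs, htS]
      simp only [Pi.add_apply]
      ring
  obtain ⟨t, ht, htS⟩ := hprod Finset.univ
  set n := ∏ s, (- m s) with hn
  -- Over all of `G` the product vanishes at every `g`, because of the factor with `s = g`.
  have ht' : ∀ g, t g = -n := by
    intro g
    have h1 := htS g
    rw [Finset.prod_eq_zero (Finset.mem_univ g) (sub_self _)] at h1
    linarith
  have hnp : ¬ (p : ℤ) ∣ n := by
    rw [hn, (Nat.prime_iff_prime_int.mp hp.out).dvd_finsetProd_iff]
    rintro ⟨s, _, hs⟩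
    rw [dvd_neg] at hs
    exact hHn s (Int.natCast_dvd_natCast.mp hs)
  -- The one-point set has trivial permutation character, so `T` now speaks of `⟨-n χ, χ⟩`.
  obtain ⟨z, hz⟩ := ht PUnit
  have h0 : (Nat.card G : K) ≠ 0 := Nat.cast_ne_zero.mpr Nat.card_pos.ne'
  have := invertibleOfNonzero h0
  have hFd : ∑ g, F g = Nat.card G * d := by
    rw [hd, ← card_inv_mul_sum_char_mul_char_eq_finrank, ← mul_assoc, mul_inv_cancel₀ h0, one_mul]
  have hpu : ∀ g : G, fixedCount PUnit.{u+1} g = 1 := by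
    intro g
    rw [fixedCount]
    simp
  simp only [ht', hpu, Nat.cast_one, one_mul, ← Finset.mul_sum, hFd] at hz
  have hz' : (-n : ℤ) * d = d ^ 2 * z := by
    have : (Nat.card G : K) * (((-n : ℤ) * d : ℤ) : K) = Nat.card G * ((d ^ 2 * z : ℤ) : K) := by
      push_cast at hz ⊢
      rw [← hz]
      ring
    exact_mod_cast mul_left_cancel₀ h0 this
  have hdn : (d : ℤ) ∣ n := by
    refine ⟨-z, ?_⟩
    have hd0' : (d : ℤ) ≠ 0 := by exact_mod_cast hd0
    apply mul_left_cancel₀ hd0'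
    linarith
  intro hpd
  exact hnp ((Int.natCast_dvd_natCast.mpr hpd).trans hdn)

/-- **Brauer's splitting theorem**: a field of characteristic zero containing enough roots of unity
is a splitting field of a finite group. -/
theorem Representation.IsIrreducible.hasScalarEnds {G : Type*} [Group G] [Finite G] {V : Type*}
    [AddCommGroup V] [Module K V] [FiniteDimensional K V] {e : ℕ} [NeZero e]
    [HasEnoughRootsOfUnity K e] (hG : ∀ g : G, g ^ e = 1) {ρ : Representation K G V}
    (hρ : ρ.IsIrreducible) : HasScalarEnds ρ := by
  have hV := ((Representation.isIrreducible_iff_forall ρ).mp hρ).1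
  refine hasScalarEnds_of_finrank (Nat.eq_one_iff_not_exists_prime_dvd.mpr fun p hp => ?_)
  have := Fact.mk hp
  exact not_dvd_finrank_intertwiningMap hG ρ hρ p

/-- The dimension of the endomorphism algebra is the norm of the character. -/
theorem HasScalarEnds.of_character_eq {G V W : Type*} [Group G] [Finite G] [AddCommGroup V]
    [Module K V] [FiniteDimensional K V] [AddCommGroup W] [Module K W] [FiniteDimensional K W]
    [Nontrivial V] [Nontrivial W] {ρ : Representation K G V} {σ : Representation K G W}
    (h : ρ.character = σ.character) (hσ : HasScalarEnds σ) : HasScalarEnds ρ := by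
  have := Fintype.ofFinite G
  have h0 : (Nat.card G : K) ≠ 0 := Nat.cast_ne_zero.mpr Nat.card_pos.ne'
  have := invertibleOfNonzero h0
  apply hasScalarEnds_of_finrank
  have h1 := finrank_intertwiningMap_eq_one hσ
  have h2 := card_inv_mul_sum_char_mul_char_eq_finrank ρ ρ
  rw [h, card_inv_mul_sum_char_mul_char_eq_finrank σ σ, h1] at h2
  exact_mod_cast h2.symm

/-- By Maschke's theorem a subrepresentation is the image of an equivariant projection; a scalar
projection is zero or the identity. -/
theorem HasScalarEnds.isIrreducible {G V : Type*} [Group G] [Finite G] [AddCommGroup V]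
    [Module K V] [Nontrivial V] {ρ : Representation K G V} (h : HasScalarEnds ρ) :
    ρ.IsIrreducible := by
  rw [Representation.isIrreducible_iff_forall]
  refine ⟨inferInstance, fun U hU => ?_⟩
  have : NeZero (Nat.card G : K) := ⟨Nat.cast_ne_zero.mpr Nat.card_pos.ne'⟩
  obtain ⟨W, hW⟩ := exists_isCompl (⟨U, fun g v hv => hU g v hv⟩ : Subrepresentation ρ)
  have hc : IsCompl U W.toSubmodule := by
    constructor
    · rw [disjoint_iff]
      exact congrArg Subrepresentation.toSubmodule hW.inf_eq_bot
    · rw [codisjoint_iff]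
      exact congrArg Subrepresentation.toSubmodule hW.sup_eq_top
  let π := U.projection W.toSubmodule hc
  have hπU : ∀ v ∈ U, π v = v := fun v hv => Submodule.projection_apply_of_mem_left hc hv
  have hπW : ∀ v ∈ W.toSubmodule, π v = 0 := fun v hv =>
    Submodule.projection_apply_of_mem_right hc hv
  obtain ⟨s, hs⟩ := h π (fun g v => by
    obtain ⟨u, hu, w, hw, rfl⟩ := Submodule.mem_sup.mp
      (hc.sup_eq_top ▸ Submodule.mem_top : v ∈ U ⊔ W.toSubmodule)
    simp only [map_add]
    rw [hπU _ (hU g u hu), hπW _ (W.apply_mem_toSubmodule g hw), hπU u hu, hπW w hw]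
    simp)
  by_cases hs0 : s = 0
  · left
    rw [eq_bot_iff]
    intro v hv
    have := hs v
    rw [hπU v hv, hs0, zero_smul] at this
    exact this
  · right
    have hWb : W.toSubmodule = ⊥ := by
      rw [eq_bot_iff]
      intro w hw
      have := hs w
      rw [hπW w hw, eq_comm, smul_eq_zero] at this
      exact this.resolve_left hs0
    have := hc.sup_eq_top
    rwa [hWb, sup_bot_eq] at this

end BrauerSplitting

/-! ### Idempotents in finite algebras over complete rings -/

section IdempotentLifting

theorem exists_pow_mul_pow_self {M : Type*} [Monoid M] [Finite M] (x : M) :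
    ∃ n : ℕ, 0 < n ∧ x ^ n * x ^ n = x ^ n := by
  obtain ⟨a, b, hab, h⟩ := Finite.exists_ne_map_eq_of_infinite (fun n : ℕ => x ^ n)
  wlog hlt : a < b generalizing a b
  · exact this b a hab.symm h.symm (lt_of_le_of_ne (not_lt.mp hlt) hab.symm)
  obtain ⟨k, hk, rfl⟩ := Nat.exists_eq_add_of_lt hlt
  set k' := k + 1
  have h1 : ∀ m, a ≤ m → x ^ (m + k') = x ^ m := by
    intro m hm
    obtain ⟨c, rfl⟩ := Nat.exists_eq_add_of_le hm
    have : a + c + k' = (a + k + 1) + c := by omega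
    rw [this, pow_add, ← h, ← pow_add]
  have h2 : ∀ j m, a ≤ m → x ^ (m + j * k') = x ^ m := by
    intro j
    induction j with
    | zero => simp
    | succ j ih =>
      intro m hm
      rw [Nat.succ_mul, ← add_assoc, h1 _ (by omega), ih m hm]
  -- The exponent is a multiple of the period `k'` and at least the preperiod `a`.
  refine ⟨(a + 1) * k', Nat.mul_pos (Nat.succ_pos _) (Nat.succ_pos _), ?_⟩
  rw [← pow_add]
  have h3 : a + 1 ≤ (a + 1) * k' := Nat.le_mul_of_pos_right _ (Nat.succ_pos k)
  exact h2 _ _ (by omega)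

universe u v

/-- For finite modules over a noetherian ring, completion is the tensor product with the completed
ring, which here is `R` itself. -/
theorem isAdicComplete_of_finite {R M : Type u} [CommRing R] [IsNoetherianRing R] (I : Ideal R)
    [IsAdicComplete I R] [AddCommGroup M] [Module R M] [Module.Finite R M] :
    IsAdicComplete I M := by
  rw [← AdicCompletion.of_bijective_iff]
  have h1 := AdicCompletion.ofTensorProduct_bijective_of_finite_of_isNoetherian I M
  let e : R ≃ₗ[R] AdicCompletion I R :=
    LinearEquiv.ofBijective (AdicCompletion.of I R) (AdicCompletion.of_bijective_iff.mpr inferInstance)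
  let f := (TensorProduct.lid R M).symm.trans (e.rTensor M)
  have : (AdicCompletion.of I M : M → AdicCompletion I M) =
      AdicCompletion.ofTensorProduct I M ∘ f := by
    funext x
    have : f x = (e 1) ⊗ₜ[R] x := by simp [f]
    rw [Function.comp_apply, this, AdicCompletion.ofTensorProduct_tmul]
    have h2 : e 1 = 1 := rfl
    rw [h2, one_smul]
  rw [this]
  exact h1.comp f.bijective

/-- The quotient `Z / I Z` is finite, so some power of `z` is idempotent there; Hensel's lemma for
`X ^ 2 - X` lifts it. -/
theorem exists_idempotent_sub_pow_mem_aux {R Z : Type u} [CommRing R] [IsNoetherianRing R] (I : Ideal R)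
    [IsAdicComplete I R] [Finite (R ⧸ I)] [CommRing Z] [Algebra R Z] [Module.Finite R Z] (z : Z) :
    ∃ (f : Z) (n : ℕ), f * f = f ∧ 0 < n ∧ f - z ^ n ∈ I.map (algebraMap R Z) := by
  set J := I.map (algebraMap R Z) with hJ
  have hc : IsAdicComplete I Z := isAdicComplete_of_finite I
  have hc' : IsAdicComplete J Z := (IsAdicComplete.map_algebraMap_iff I Z).mpr hc
  have hfin : Finite (Z ⧸ J) := by
    let _ : Algebra (R ⧸ I) (Z ⧸ J) := Ideal.Quotient.algebraQuotientOfLEComap Ideal.le_comap_map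
    have : IsScalarTower R (R ⧸ I) (Z ⧸ J) := IsScalarTower.of_algebraMap_eq' rfl
    have : Module.Finite (R ⧸ I) (Z ⧸ J) := Module.Finite.of_restrictScalars_finite R _ _
    exact Module.finite_of_finite (R ⧸ I)
  obtain ⟨n, hn, hid⟩ := exists_pow_mul_pow_self (Ideal.Quotient.mk J z)
  rw [← map_pow] at hid
  have hmem : z ^ n * z ^ n - z ^ n ∈ J := by
    rw [← Ideal.Quotient.eq, map_mul, hid]
  have hu : IsUnit (Ideal.Quotient.mk J
      ((Polynomial.X ^ 2 - Polynomial.X : Polynomial Z).derivative.eval (z ^ n))) := by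
    -- The derivative `2 z ^ n - 1` squares to one modulo `J`, so it is its own inverse.
    refine IsUnit.of_mul_eq_one (b := Ideal.Quotient.mk J (2 * z ^ n - 1)) ?_
    rw [← map_mul, ← map_one (Ideal.Quotient.mk J), Ideal.Quotient.eq]
    have : (Polynomial.X ^ 2 - Polynomial.X : Polynomial Z).derivative.eval (z ^ n) *
        (2 * z ^ n - 1) - 1 = 4 * (z ^ n * z ^ n - z ^ n) := by
      simp
      ring
    rw [this]
    exact J.mul_mem_left _ hmem
  have hmonic : (Polynomial.X ^ 2 - Polynomial.X : Polynomial Z).Monic := by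
    nontriviality Z
    exact Polynomial.monic_X_pow_sub (by rw [Polynomial.degree_X]; norm_num)
  obtain ⟨f, hf, hfz⟩ := HenselianRing.is_henselian (I := J) _ hmonic (z ^ n)
    (by simpa [sq] using hmem) hu
  refine ⟨f, n, ?_, hn, hfz⟩
  rw [Polynomial.IsRoot.def] at hf
  simpa [sq, sub_eq_zero] using hf

/-- As a quotient of a finite free `R`-module, `Z` has a copy in the universe of `R`. -/
theorem exists_idempotent_sub_pow_mem {R : Type u} {Z : Type v} [CommRing R] [IsNoetherianRing R]
    (I : Ideal R) [IsAdicComplete I R] [Finite (R ⧸ I)] [CommRing Z] [Algebra R Z]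
    [Module.Finite R Z] (z : Z) :
    ∃ (f : Z) (n : ℕ), f * f = f ∧ 0 < n ∧ f - z ^ n ∈ I.map (algebraMap R Z) := by
  obtain ⟨m, g, hg⟩ := Module.Finite.exists_fin' R Z
  have : Small.{u} Z := small_of_surjective hg
  let e : Shrink.{u} Z ≃ₐ[R] Z := Shrink.algEquiv R Z
  have : Module.Finite R (Shrink.{u} Z) := Module.Finite.equiv e.symm.toLinearEquiv
  obtain ⟨f, n, hf, hn, hfz⟩ := exists_idempotent_sub_pow_mem_aux I (e.symm z)
  refine ⟨e f, n, by rw [← map_mul, hf], hn, ?_⟩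
  have h1 := Ideal.mem_map_of_mem (e : Shrink.{u} Z →+* Z) hfz
  rw [Ideal.map_map] at h1
  have h2 : (e : Shrink.{u} Z →+* Z).comp (algebraMap R (Shrink.{u} Z)) = algebraMap R Z := by
    ext r
    simp
  rw [h2] at h1
  simpa using h1

/-- A ring homomorphism to a field that is `1` on a primitive idempotent `e` of a finite algebra
over a complete ring is determined by `e` up to its kernel. -/
theorem eq_zero_of_primitive {R Z k : Type*} [CommRing R] [IsNoetherianRing R] (I : Ideal R)
    [IsAdicComplete I R] [Finite (R ⧸ I)] [CommRing Z] [Algebra R Z] [Module.Finite R Z] [Field k]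
    {e : Z} (he : ∀ f : Z, f * f = f → f * e = f → f = 0 ∨ f = e) (hid : e * e = e)
    (θ₁ θ₂ : Z →+* k) (h₁ : θ₁ e = 1) (h₂ : θ₂ e = 1)
    (hI₁ : ∀ r ∈ I, θ₁ (algebraMap R Z r) = 0) (hI₂ : ∀ r ∈ I, θ₂ (algebraMap R Z r) = 0)
    {z : Z} (hz : θ₂ z = 0) : θ₁ z = 0 := by
  by_contra hne
  obtain ⟨f, n, hf, hn, hmem⟩ := exists_idempotent_sub_pow_mem I z
  -- If `θ₁ z ≠ 0 = θ₂ z`, the idempotent `f` is nonzero under `θ₁` and zero under `θ₂`. Then `f *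
  -- e` is neither `0` nor `e`, against primitivity.
  have hJ : ∀ θ : Z →+* k, (∀ r ∈ I, θ (algebraMap R Z r) = 0) → θ f = θ z ^ n := by
    intro θ hθ
    have : I.map (algebraMap R Z) ≤ RingHom.ker θ := Ideal.map_le_iff_le_comap.mpr hθ
    have := RingHom.mem_ker.mp (this hmem)
    rwa [map_sub, map_pow, sub_eq_zero] at this
  rcases he (f * e) (by rw [mul_mul_mul_comm, hf, hid]) (by rw [mul_assoc, hid]) with h | h
  · have := congrArg θ₁ h
    rw [map_mul, h₁, mul_one, hJ θ₁ hI₁, map_zero] at this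
    exact hne (pow_eq_zero_iff hn.ne' |>.mp this)
  · have := congrArg θ₂ h
    rw [map_mul, h₂, mul_one, hJ θ₂ hI₂, hz, zero_pow hn.ne'] at this
    exact zero_ne_one this

/-- Idempotents decrease as the ideals generated by `1 - e` increase, so a maximal such ideal gives
a minimal `e` with `θ e = 1`. For `f` below `e`, one of `f` and `e - f` is sent to `1`. -/
theorem exists_primitive_idempotent {Z S : Type*} [CommRing Z] [IsNoetherianRing Z] [CommRing S]
    [IsDomain S] (θ : Z →+* S) :
    ∃ e : Z, e * e = e ∧ θ e = 1 ∧ ∀ f : Z, f * f = f → f * e = f → f = 0 ∨ f = e := by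
  let P : Set (Ideal Z) := {I | ∃ e : Z, e * e = e ∧ θ e = 1 ∧ I = Ideal.span {1 - e}}
  have hP : P.Nonempty := ⟨_, 1, by simp, by simp, rfl⟩
  obtain ⟨_, ⟨e, he, hθ, rfl⟩, hmax⟩ := set_has_maximal_iff_noetherian.mpr ‹_› P hP
  have key : ∀ f : Z, f * f = f → f * e = f → θ f = 1 → f = e := by
    intro f hf hfe hθf
    have hle : Ideal.span {1 - e} ≤ Ideal.span {1 - f} := by
      rw [Ideal.span_singleton_le_span_singleton]
      refine ⟨1 - e, ?_⟩
      linear_combination -hfe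
    have hnlt := hmax _ ⟨f, hf, hθf, rfl⟩
    have heq : Ideal.span {1 - e} = Ideal.span {1 - f} := hle.eq_of_not_lt hnlt
    have : Ideal.span {1 - f} ≤ Ideal.span {1 - e} := heq.ge
    rw [Ideal.span_singleton_le_span_singleton] at this
    obtain ⟨r, hr⟩ := this
    linear_combination -e * hr + r * he - hfe
  refine ⟨e, he, hθ, fun f hf hfe => ?_⟩
  have h01 : θ f = 0 ∨ θ f = 1 := by
    have : θ f * (θ f - 1) = 0 := by rw [mul_sub, ← map_mul, hf, mul_one, sub_self]
    rcases mul_eq_zero.mp this with h | h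
    · exact Or.inl h
    · exact Or.inr (sub_eq_zero.mp h)
  rcases h01 with h | h
  · left
    have := key (e - f) (by linear_combination he - 2 * hfe + hf) (by linear_combination he - hfe)
      (by rw [map_sub, hθ, h, sub_zero])
    linear_combination -this
  · exact Or.inr (key f hf hfe h)

end IdempotentLifting

/-! ### Group algebras acting by scalars -/

section ScalarAction

variable {K : Type*} [Field K]

/-- The action of the group algebra over `R` on a representation over the `R`-algebra `K`. -/
noncomputable def repAct (R : Type*) {K G V : Type*} [CommRing R] [Field K] [Algebra R K] [Group G]
    [AddCommGroup V] [Module K V] (ρ : Representation K G V) : MonoidAlgebra R G →+* Module.End K V :=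
  (ρ.asAlgebraHom : MonoidAlgebra K G →+* Module.End K V).comp
    (MonoidAlgebra.mapRingHom G (algebraMap R K))

variable {R : Type*} [CommRing R] [Algebra R K]

section General

variable {G V : Type*} [Group G] [AddCommGroup V] [Module K V] (ρ : Representation K G V)

@[simp]
theorem repAct_single (g : G) (r : R) :
    repAct R ρ (MonoidAlgebra.single g r) = algebraMap R K r • ρ g := by
  simp [repAct]

theorem repAct_algebraMap (r : R) :
    repAct R ρ (algebraMap R _ r) = algebraMap R K r • 1 := by
  rw [MonoidAlgebra.coe_algebraMap]
  simp

theorem evalAlg_character (x : MonoidAlgebra R G) :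
    evalAlg ρ.character x = LinearMap.trace K V (repAct R ρ x) := by
  induction x using MonoidAlgebra.induction_linear with
  | zero => simp [evalAlg]
  | add x y hx hy =>
    rw [map_add, map_add, ← hx, ← hy, evalAlg, MonoidAlgebra.coeff_add]
    exact Finsupp.sum_add_index' (by simp) (by intros; simp [add_mul])
  | single g r => simp [evalAlg, Representation.character]

theorem repAct_comp {L : Type*} [Group L] (i : L →* G) (x : MonoidAlgebra R L) :
    repAct R (MonoidHom.comp ρ i : Representation K L V) x =
      repAct R ρ (MonoidAlgebra.mapDomainRingHom R i x) := by
  induction x using MonoidAlgebra.induction_linear with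
  | zero => simp
  | add x y hx hy => rw [map_add, map_add, map_add, hx, hy]
  | single g r => simp

/-- The group algebra of a finite group is integral over `R`, so the scalar is integral and
therefore lies in `R`. -/
theorem exists_algebraMap_smul_of_smul [Finite G] [Nontrivial V] [IsIntegrallyClosedIn R K]
    {x : MonoidAlgebra R G} {t : K} (ht : ∀ v, repAct R ρ x v = t • v) :
    ∃ s : R, ∀ v, repAct R ρ x v = algebraMap R K s • v := by
  have hint : IsIntegral R x := Algebra.IsIntegral.isIntegral x
  have ht' : repAct R ρ x = algebraMap K (Module.End K V) t := by
    ext v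
    rw [ht]
    rfl
  have hint' : IsIntegral R t := by
    obtain ⟨p, hp, hpx⟩ := hint
    refine ⟨p, hp, ?_⟩
    have h1 := congrArg (repAct R ρ) hpx
    rw [Polynomial.hom_eval₂, map_zero, ht'] at h1
    have h2 : (repAct R ρ).comp (algebraMap R (MonoidAlgebra R G)) =
        (algebraMap K (Module.End K V)).comp (algebraMap R K) := by
      ext1 r
      exact repAct_algebraMap ρ r
    rw [h2, ← Polynomial.hom_eval₂] at h1
    exact (map_eq_zero_iff _ (FaithfulSMul.algebraMap_injective K (Module.End K V))).mp h1
  obtain ⟨s, rfl⟩ := IsIntegrallyClosedIn.algebraMap_eq_of_integral hint'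
  exact ⟨s, ht⟩

theorem smul_injective_of_nontrivial [Nontrivial V] [IsIntegrallyClosedIn R K] {s t : R}
    (h : ∀ v : V, algebraMap R K s • v = algebraMap R K t • v) : s = t := by
  obtain ⟨w, hw⟩ := exists_ne (0 : V)
  exact (isIntegrallyClosedIn_iff.mp ‹_›).1 (smul_left_injective K hw (h w))

/-- The scalars through which a ring acts form a ring homomorphism. -/
theorem exists_ringHom_of_scalar [Nontrivial V] [IsIntegrallyClosedIn R K] {Z : Type*} [Ring Z]
    (a : Z →+* Module.End K V) (h : ∀ z, ∃ s : R, ∀ v, a z v = algebraMap R K s • v) :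
    ∃ θ : Z →+* R, ∀ z v, a z v = algebraMap R K (θ z) • v := by
  choose θ hθ using h
  refine ⟨{ toFun := θ, map_one' := ?_, map_mul' := ?_, map_zero' := ?_, map_add' := ?_ }, hθ⟩
  · exact smul_injective_of_nontrivial (V := V) fun v => by rw [← hθ]; simp
  · intro x y
    exact smul_injective_of_nontrivial (V := V) fun v => by
      rw [← hθ, map_mul, Module.End.mul_apply, hθ y, map_smul, hθ x, smul_smul, map_mul, mul_comm]
  · exact smul_injective_of_nontrivial (V := V) fun v => by rw [← hθ]; simp
  · intro x y
    exact smul_injective_of_nontrivial (V := V) fun v => by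
      rw [← hθ, map_add, LinearMap.add_apply, hθ y, hθ x, map_add, add_smul]

theorem exists_scalar_of_center [Finite G] [Nontrivial V] [IsIntegrallyClosedIn R K]
    (hρ : HasScalarEnds ρ) {x : MonoidAlgebra R G} (hx : ∀ y, y * x = x * y) :
    ∃ s : R, ∀ v, repAct R ρ x v = algebraMap R K s • v := by
  obtain ⟨t, ht⟩ := hρ (repAct R ρ x) (fun g v => by
    have := congrArg (repAct R ρ) (hx (MonoidAlgebra.single g 1))
    rw [map_mul, map_mul, repAct_single, map_one, one_smul] at this
    exact (LinearMap.congr_fun this v).symm)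
  exact exists_algebraMap_smul_of_smul ρ ht

theorem evalAlg_eq_of_repAct_eq_one {x : MonoidAlgebra R G}
    (h : repAct R ρ x = 1) : evalAlg ρ.character x = ρ.character 1 := by
  rw [evalAlg_character, h, Representation.character, map_one ρ]

theorem repAct_eq_one_of_evalAlg [CharZero K] [FiniteDimensional K V] [Finite G] [Nontrivial V]
    [IsIntegrallyClosedIn R K] (hρ : HasScalarEnds ρ) {e : MonoidAlgebra R G}
    (he : e ∈ Subring.center (MonoidAlgebra R G))
    (h : evalAlg ρ.character e = ρ.character 1) : repAct R ρ e = 1 := by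
  obtain ⟨s, hs⟩ := exists_scalar_of_center (R := R) ρ hρ (Subring.mem_center_iff.mp he)
  have h1 : repAct R ρ e = algebraMap R K s • 1 := by
    ext v
    simp [hs]
  rw [evalAlg_character, h1, map_smul, LinearMap.trace_one, char_one, smul_eq_mul] at h
  have h0 : (finrank K V : K) ≠ 0 := Nat.cast_ne_zero.mpr finrank_pos.ne'
  rw [h1, (mul_eq_right₀ h0).mp h, one_smul]

end General

/-! ### Blocks and central characters -/

section Blocks

variable {R₀ : Type*} [CommRing R₀] [IsNoetherianRing R₀] [Algebra R₀ R] [Module.Finite R₀ R]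
  [IsIntegrallyClosedIn R K] {G V W : Type*} [Group G] [Finite G] [AddCommGroup V] [Module K V]
  [Nontrivial V] [AddCommGroup W] [Module K W] [Nontrivial W]
  {ρ : Representation K G V} {σ : Representation K G W}

theorem finite_center (R₀ R G : Type*) [CommRing R₀] [IsNoetherianRing R₀] [CommRing R]
    [Algebra R₀ R] [Module.Finite R₀ R] [Group G] [Finite G] :
    Module.Finite R₀ (Subalgebra.center R₀ (MonoidAlgebra R G)) :=
  have : IsNoetherian R₀ (MonoidAlgebra R G) := isNoetherian_of_isNoetherianRing_of_finite R₀ _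
  inferInstanceAs
    (Module.Finite R₀ (Subalgebra.toSubmodule (Subalgebra.center R₀ (MonoidAlgebra R G))))

/-- Irreducible characters of a common block have congruent central characters. -/
theorem centralCharacter_congr (I : Ideal R₀) [IsAdicComplete I R₀] [Finite (R₀ ⧸ I)]
    {k : Type*} [Field k] (red : R →+* k) (hred : ∀ r ∈ I, red (algebraMap R₀ R r) = 0)
    (hρ : HasScalarEnds ρ) (hσ : HasScalarEnds σ) {e : MonoidAlgebra R G} (he : IsBlock e)
    (hρe : repAct R ρ e = 1) (hσe : repAct R σ e = 1) {z : MonoidAlgebra R G}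
    (hz : ∀ y, y * z = z * y) {s t : R} (hs : ∀ v, repAct R ρ z v = algebraMap R K s • v)
    (ht : ∀ v, repAct R σ z v = algebraMap R K t • v) : red s = red t := by
  have := finite_center R₀ R G
  have hcenter : ∀ {x : MonoidAlgebra R G}, x ∈ Subring.center (MonoidAlgebra R G) ↔
      x ∈ Subalgebra.center R₀ (MonoidAlgebra R G) := by
    intro x
    rw [Subring.mem_center_iff, Subalgebra.mem_center_iff]
  let ι : Subalgebra.center R₀ (MonoidAlgebra R G) →+* MonoidAlgebra R G :=
    (Subalgebra.center R₀ (MonoidAlgebra R G)).val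
  obtain ⟨θ₁, hθ₁⟩ := exists_ringHom_of_scalar (R := R) ((repAct R ρ).comp ι) (fun z =>
    exists_scalar_of_center ρ hρ (Subalgebra.mem_center_iff.mp z.2))
  obtain ⟨θ₂, hθ₂⟩ := exists_ringHom_of_scalar (R := R) ((repAct R σ).comp ι) (fun z =>
    exists_scalar_of_center σ hσ (Subalgebra.mem_center_iff.mp z.2))
  have halg₁ : ∀ (r : R) (h : algebraMap R _ r ∈ Subalgebra.center R₀ (MonoidAlgebra R G)),
      θ₁ ⟨_, h⟩ = r := fun r h => smul_injective_of_nontrivial (V := V) fun v => by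
    rw [← hθ₁]
    simp [ι]
  have halg₂ : ∀ (r : R) (h : algebraMap R _ r ∈ Subalgebra.center R₀ (MonoidAlgebra R G)),
      θ₂ ⟨_, h⟩ = r := fun r h => smul_injective_of_nontrivial (V := W) fun v => by
    rw [← hθ₂]
    simp [ι]
  have hmem : ∀ r : R, algebraMap R _ r ∈ Subalgebra.center R₀ (MonoidAlgebra R G) := fun r =>
    Subalgebra.mem_center_iff.mpr fun y => (Algebra.commutes r y).symm
  let e' : Subalgebra.center R₀ (MonoidAlgebra R G) := ⟨e, hcenter.mp he.central⟩
  let z' : Subalgebra.center R₀ (MonoidAlgebra R G) := ⟨z, Subalgebra.mem_center_iff.mpr hz⟩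
  have h1 : θ₁ z' = s := smul_injective_of_nontrivial (V := V) fun v => by
    rw [← hθ₁, ← hs]; rfl
  have h2 : θ₂ z' = t := smul_injective_of_nontrivial (V := W) fun v => by
    rw [← hθ₂, ← ht]; rfl
  have h3 : θ₁ e' = 1 := smul_injective_of_nontrivial (V := V) fun v => by
    rw [← hθ₁]; simp [ι, e', hρe]
  have h4 : θ₂ e' = 1 := smul_injective_of_nontrivial (V := W) fun v => by
    rw [← hθ₂]; simp [ι, e', hσe]
  have hI : ∀ r, algebraMap R₀ (Subalgebra.center R₀ (MonoidAlgebra R G)) r =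
      ⟨_, hmem (algebraMap R₀ R r)⟩ := fun r => Subtype.ext
        (IsScalarTower.algebraMap_apply R₀ R (MonoidAlgebra R G) r)
  -- Apply the separation property of primitive idempotents to `z - t`, which the second central
  -- character kills.
  have key := eq_zero_of_primitive I (e := e') (fun f hf hfe => ?_) (Subtype.ext he.idem)
    (red.comp θ₁) (red.comp θ₂) (by simp [h3]) (by simp [h4])
    (fun r hr => by rw [RingHom.comp_apply, hI, halg₁, hred r hr])
    (fun r hr => by rw [RingHom.comp_apply, hI, halg₂, hred r hr])
    (z := z' - ⟨_, hmem t⟩) (by rw [RingHom.comp_apply, map_sub, h2, halg₂, sub_self, map_zero])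
  · rwa [RingHom.comp_apply, map_sub, h1, halg₁, map_sub, sub_eq_zero] at key
  · rcases he.primitive f (hcenter.mpr f.2) (congrArg Subtype.val hf) (congrArg Subtype.val hfe)
      with h | h
    · exact Or.inl (Subtype.ext h)
    · exact Or.inr (Subtype.ext h)

/-- Irreducible characters with congruent central characters lie in a common block. -/
theorem sameBlock_of_congr [CharZero K] [IsDomain R] {k : Type*} [Field k] (red : R →+* k) {n m : ℕ}
    [NeZero n] [NeZero m] {ρ : Representation K G (Fin n → K)} {σ : Representation K G (Fin m → K)}
    (R₀ : Type*) [CommRing R₀] [IsNoetherianRing R₀] [Algebra R₀ R] [Module.Finite R₀ R]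
    (hρ : HasScalarEnds ρ) (hσ : HasScalarEnds σ)
    (h : ∀ (z : MonoidAlgebra R G) (s t : R), (∀ y, y * z = z * y) →
      (∀ v, repAct R ρ z v = algebraMap R K s • v) →
      (∀ v, repAct R σ z v = algebraMap R K t • v) → red s = red t) :
    SameBlock R ρ.character σ.character := by
  have := finite_center R₀ R G
  have : IsNoetherianRing (Subalgebra.center R₀ (MonoidAlgebra R G)) :=
    IsNoetherianRing.of_finite R₀ _
  let ι : Subalgebra.center R₀ (MonoidAlgebra R G) →+* MonoidAlgebra R G :=
    (Subalgebra.center R₀ (MonoidAlgebra R G)).val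
  obtain ⟨θ₁, hθ₁⟩ := exists_ringHom_of_scalar (R := R) ((repAct R ρ).comp ι) (fun z =>
    exists_scalar_of_center ρ hρ (Subalgebra.mem_center_iff.mp z.2))
  obtain ⟨θ₂, hθ₂⟩ := exists_ringHom_of_scalar (R := R) ((repAct R σ).comp ι) (fun z =>
    exists_scalar_of_center σ hσ (Subalgebra.mem_center_iff.mp z.2))
  obtain ⟨e, hid, he1, hprim⟩ := exists_primitive_idempotent θ₁
  -- `θ₂ e` is `0` or `1` in the domain `R`, and it is congruent to `θ₁ e = 1`.
  have he2 : θ₂ e = 1 := by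
    have h01 : θ₂ e = 0 ∨ θ₂ e = 1 := by
      have : θ₂ e * (θ₂ e - 1) = 0 := by rw [mul_sub, ← map_mul, hid, mul_one, sub_self]
      rcases mul_eq_zero.mp this with h | h
      · exact Or.inl h
      · exact Or.inr (sub_eq_zero.mp h)
    have hcong := h e (θ₁ e) (θ₂ e) (Subalgebra.mem_center_iff.mp e.2) (hθ₁ e) (hθ₂ e)
    refine h01.resolve_left fun h0 => ?_
    rw [he1, h0, map_one, map_zero] at hcong
    exact one_ne_zero hcong
  have hρe : repAct R ρ e = 1 := by
    refine LinearMap.ext fun v => ?_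
    have := hθ₁ e
    simp only [he1, map_one, one_smul] at this
    exact this _
  have hσe : repAct R σ e = 1 := by
    refine LinearMap.ext fun v => ?_
    have := hθ₂ e
    simp only [he2, map_one, one_smul] at this
    exact this _
  refine ⟨e, ⟨?_, congrArg Subtype.val hid, ?_, ?_⟩, ⟨⟨n, ρ, hρ.isIrreducible, rfl⟩, ?_⟩,
    ⟨⟨m, σ, hσ.isIrreducible, rfl⟩, ?_⟩⟩
  · exact Subring.mem_center_iff.mpr (Subalgebra.mem_center_iff.mp e.2)
  · intro h0
    have : e = 0 := Subtype.ext h0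
    rw [this, map_zero] at he1
    exact zero_ne_one he1
  · intro f hf hff hfe
    rcases hprim ⟨f, Subalgebra.mem_center_iff.mpr (Subring.mem_center_iff.mp hf)⟩
      (Subtype.ext hff) (Subtype.ext hfe) with h | h
    · exact Or.inl (congrArg Subtype.val h)
    · exact Or.inr (congrArg Subtype.val h)
  · exact evalAlg_eq_of_repAct_eq_one ρ hρe
  · exact evalAlg_eq_of_repAct_eq_one σ hσe

end Blocks

end ScalarAction

/-! ### Action of the graded centralizer on extensions -/

section GradedAction

variable {K R A : Type*} [Field K] [CommRing R] [Algebra R K] [Group A]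

theorem incl_injective (N : Subgroup A) : Function.Injective (incl R N) := by
  intro x y h
  exact MonoidAlgebra.mapDomain_injective N.subtype_injective h

@[simp]
theorem incl_single (N : Subgroup A) (n : N) (r : R) :
    incl R N (MonoidAlgebra.single n r) = MonoidAlgebra.single (n : A) r := by
  simp [incl]

theorem incl_inclusion {L H : Subgroup A} (h : L ≤ H) (x : MonoidAlgebra R L) :
    incl R H (MonoidAlgebra.mapDomainRingHom R (Subgroup.inclusion h) x) = incl R L x := by
  induction x using MonoidAlgebra.induction_linear with
  | zero => simp
  | add x y hx hy => rw [map_add, map_add, map_add, hx, hy]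
  | single g r => simp

theorem exists_incl_eq {H : Subgroup A} {c : MonoidAlgebra R A}
    (h : ∀ x, c.coeff x ≠ 0 → x ∈ H) : ∃ y, incl R H y = c := by
  refine ⟨MonoidAlgebra.ofCoeff (c.coeff.comapDomain Subtype.val Subtype.val_injective.injOn), ?_⟩
  apply MonoidAlgebra.coeff_injective
  rw [incl, MonoidAlgebra.mapDomainRingHom_apply, MonoidAlgebra.coeff_mapDomain]
  refine Finsupp.mapDomain_comapDomain _ Subtype.val_injective _ fun x hx => ?_
  exact ⟨⟨x, h x (Finsupp.mem_support_iff.mp hx)⟩, rfl⟩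

theorem coeff_conj (a : A) (c : MonoidAlgebra R A) (x : A) :
    (MonoidAlgebra.of R A a * c * MonoidAlgebra.of R A a⁻¹).coeff x =
      c.coeff (a⁻¹ * x * a) := by
  rw [MonoidAlgebra.of_apply, MonoidAlgebra.of_apply, MonoidAlgebra.coeff_mul_single_apply,
    MonoidAlgebra.coeff_single_mul_apply]
  simp [mul_assoc]

theorem commute_incl_iff {N : Subgroup A} {c : MonoidAlgebra R A} :
    (∀ x : MonoidAlgebra R N, Commute c (incl R N x)) ↔
      ∀ n ∈ N, MonoidAlgebra.of R A n * c * MonoidAlgebra.of R A n⁻¹ = c := by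
  have hcancel : ∀ n : A, MonoidAlgebra.of R A n * MonoidAlgebra.of R A n⁻¹ = 1 := fun n => by
    rw [← map_mul, mul_inv_cancel, map_one]
  have hcancel' : ∀ n : A, MonoidAlgebra.of R A n⁻¹ * MonoidAlgebra.of R A n = 1 := fun n => by
    rw [← map_mul, inv_mul_cancel, map_one]
  constructor
  · intro h n hn
    have := h (MonoidAlgebra.single ⟨n, hn⟩ 1)
    rw [incl_single] at this
    rw [MonoidAlgebra.of_apply, ← this.eq, mul_assoc, ← MonoidAlgebra.of_apply, hcancel, mul_one]
  · intro h x
    induction x using MonoidAlgebra.induction_linear with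
    | zero => simp
    | add x y hx hy => rw [map_add]; exact hx.add_right hy
    | single n r =>
      have h1 : Commute c (MonoidAlgebra.of R A (n : A)) := by
        have := congrArg (· * MonoidAlgebra.of R A (n : A)) (h n n.2)
        simp only [mul_assoc, hcancel', mul_one] at this
        exact this.symm
      rw [incl_single]
      have h2 : MonoidAlgebra.single (n : A) r = r • MonoidAlgebra.of R A (n : A) := by
        simp
      rw [h2]
      exact h1.smul_right r

theorem conj_conj (a a' : A) (c : MonoidAlgebra R A) :
    MonoidAlgebra.of R A a * (MonoidAlgebra.of R A a' * c * MonoidAlgebra.of R A a'⁻¹) *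
      MonoidAlgebra.of R A a⁻¹ =
    MonoidAlgebra.of R A (a * a') * c * MonoidAlgebra.of R A (a * a')⁻¹ := by
  rw [mul_inv_rev, map_mul, map_mul]
  noncomm_ring

theorem gradedPart_conj {N : Subgroup A} [N.Normal] {g : A} {c : MonoidAlgebra R A}
    (hc : c ∈ gradedPart R N g) (a : A) :
    MonoidAlgebra.of R A a * c * MonoidAlgebra.of R A a⁻¹ ∈ gradedPart R N (a * g * a⁻¹) := by
  refine ⟨fun x hx => ?_, ?_⟩
  · rw [coeff_conj] at hx
    have := Subgroup.Normal.conj_mem ‹N.Normal› _ (hc.1 _ hx) a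
    convert! this using 1
    group
  · have h := commute_incl_iff.mp hc.2
    rw [commute_incl_iff]
    intro n hn
    have hn' : a⁻¹ * n * a ∈ N := by
      simpa using Subgroup.Normal.conj_mem ‹N.Normal› n hn a⁻¹
    rw [conj_conj]
    have : n * a = a * (a⁻¹ * n * a) := by group
    rw [this, ← conj_conj, h _ hn']

theorem exists_incl_of_mem_gradedPart {N H : Subgroup A} (hNH : N ≤ H) {g : A} (hg : g ∈ H)
    {c : MonoidAlgebra R A} (hc : c ∈ gradedPart R N g) : ∃ y, incl R H y = c :=
  exists_incl_eq fun x hx => by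
    have := H.mul_mem (hNH (hc.1 x hx)) hg
    simpa using this

variable {H : Subgroup A} {V : Type*} [AddCommGroup V] [Module K V]

/-- The element `c` of the group algebra of `A` lies in the group algebra of `H` and acts by the
scalar `s` on the representation `ρ` of `H`. -/
def ActsBy (ρ : Representation K H V) (c : MonoidAlgebra R A) (s : R) : Prop :=
  ∃ x, incl R H x = c ∧ ∀ v, repAct R ρ x v = algebraMap R K s • v

theorem ActsBy.unique [Nontrivial V] [IsIntegrallyClosedIn R K] {ρ : Representation K H V}
    {c : MonoidAlgebra R A} {s t : R} (hs : ActsBy ρ c s) (ht : ActsBy ρ c t) : s = t := by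
  obtain ⟨x, hx, hs⟩ := hs
  obtain ⟨y, hy, ht⟩ := ht
  obtain rfl := incl_injective H (hx.trans hy.symm)
  exact smul_injective_of_nontrivial (V := V) fun v => by rw [← hs, ht]

theorem ActsBy.mul {ρ : Representation K H V} {c d : MonoidAlgebra R A} {s t : R}
    (hs : ActsBy ρ c s) (ht : ActsBy ρ d t) : ActsBy ρ (c * d) (s * t) := by
  obtain ⟨x, rfl, hs⟩ := hs
  obtain ⟨y, rfl, ht⟩ := ht
  refine ⟨x * y, map_mul _ _ _, fun v => ?_⟩
  rw [map_mul, Module.End.mul_apply, ht, map_smul, hs, smul_smul, map_mul, mul_comm]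

theorem ActsBy.sum {ρ : Representation K H V} {ι : Type*} (S : Finset ι) {c : ι → MonoidAlgebra R A}
    {s : ι → R} (h : ∀ i ∈ S, ActsBy ρ (c i) (s i)) : ActsBy ρ (∑ i ∈ S, c i) (∑ i ∈ S, s i) := by
  classical
  induction S using Finset.induction_on with
  | empty => exact ⟨0, by simp, by simp⟩
  | insert i S hi ih =>
    obtain ⟨x, hx, hs⟩ := h i (Finset.mem_insert_self i S)
    obtain ⟨y, hy, ht⟩ := ih fun j hj => h j (Finset.mem_insert_of_mem hj)
    rw [Finset.sum_insert hi, Finset.sum_insert hi]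
    refine ⟨x + y, by rw [map_add, hx, hy], fun v => ?_⟩
    rw [map_add, LinearMap.add_apply, hs, ht, map_add, add_smul]

theorem actsBy_incl_iff {L : Subgroup A} (h : L ≤ H) {ρ : Representation K H V}
    {x : MonoidAlgebra R L} {s : R} : ActsBy ρ (incl R L x) s ↔
      ∀ v, repAct R (MonoidHom.comp ρ (Subgroup.inclusion h) : Representation K L V) x v =
        algebraMap R K s • v := by
  rw [repAct_comp]
  constructor
  · rintro ⟨y, hy, hs⟩ v
    rw [← incl_inclusion h] at hy
    rw [← incl_injective H hy, hs]
  · intro hs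
    exact ⟨_, incl_inclusion h x, hs⟩

/-- An element commuting with `R N` acts by an `N`-endomorphism, so the scalar comes from the
restriction to `N`. -/
theorem exists_actsBy [Finite H] [Nontrivial V] [IsIntegrallyClosedIn R K] {N : Subgroup A}
    (hNH : N ≤ H) {ρ : Representation K H V}
    (hρ : HasScalarEnds (MonoidHom.comp ρ (Subgroup.inclusion hNH) : Representation K N V))
    {c : MonoidAlgebra R A} (hc : ∃ y, incl R H y = c)
    (hcN : ∀ x : MonoidAlgebra R N, Commute c (incl R N x)) : ∃ s : R, ActsBy ρ c s := by
  obtain ⟨y, rfl⟩ := hc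
  obtain ⟨t, ht⟩ := hρ (repAct R ρ y) (fun n v => by
    have h1 := hcN (MonoidAlgebra.single n 1)
    rw [← incl_inclusion hNH] at h1
    have h2 : y * MonoidAlgebra.mapDomainRingHom R (Subgroup.inclusion hNH)
        (MonoidAlgebra.single n 1) = MonoidAlgebra.mapDomainRingHom R (Subgroup.inclusion hNH)
        (MonoidAlgebra.single n 1) * y := incl_injective H (by rw [map_mul, map_mul]; exact h1.eq)
    have h3 := congrArg (repAct R ρ) h2
    rw [map_mul, map_mul] at h3
    have h4 := LinearMap.congr_fun h3 v
    simpa using h4)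
  obtain ⟨s, hs⟩ := exists_algebraMap_smul_of_smul ρ ht
  exact ⟨s, y, rfl, hs⟩

theorem ActsBy.conj {ρ : Representation K H V} {c : MonoidAlgebra R A} {s : R} (hs : ActsBy ρ c s)
    {h : A} (hh : h ∈ H) :
    ActsBy ρ (MonoidAlgebra.of R A h * c * MonoidAlgebra.of R A h⁻¹) s := by
  obtain ⟨x, rfl, hs⟩ := hs
  refine ⟨MonoidAlgebra.of R H ⟨h, hh⟩ * x * MonoidAlgebra.of R H ⟨h, hh⟩⁻¹, by simp, fun v => ?_⟩
  rw [map_mul, map_mul, Module.End.mul_apply, Module.End.mul_apply, hs, map_smul,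
    ← Module.End.mul_apply, ← map_mul, ← map_mul, mul_inv_cancel, map_one, map_one,
    Module.End.one_apply]

/-- The operator `ρ a` is available because the representation is defined on all of `A`. As `a` need
not normalize `H`, it is assumed that the conjugate stays in the group algebra of `H`. -/
theorem ActsBy.conj_of_extension {ρ : Representation K A V} {c : MonoidAlgebra R A} {s : R}
    (hs : ActsBy (MonoidHom.comp ρ H.subtype : Representation K H V) c s) (a : A)
    (hc : ∃ y, incl R H y = MonoidAlgebra.of R A a * c * MonoidAlgebra.of R A a⁻¹) :
    ActsBy (MonoidHom.comp ρ H.subtype : Representation K H V)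
      (MonoidAlgebra.of R A a * c * MonoidAlgebra.of R A a⁻¹) s := by
  obtain ⟨x, rfl, hs⟩ := hs
  obtain ⟨y, hy⟩ := hc
  refine ⟨y, hy, fun v => ?_⟩
  have h1 : ∀ v, repAct R ρ (incl R H x) v = algebraMap R K s • v := by
    intro v
    rw [← hs, repAct_comp]
    rfl
  rw [repAct_comp]
  change repAct R ρ (incl R H y) v = _
  rw [hy, map_mul, map_mul, Module.End.mul_apply, Module.End.mul_apply, h1, map_smul,
    ← Module.End.mul_apply, ← map_mul, ← map_mul, mul_inv_cancel, map_one, map_one,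
    Module.End.one_apply]

/-- The sum of the conjugates of an element commuting with `N` under `L/N`. -/
noncomputable def conjSum (N L : Subgroup A) [Fintype (L ⧸ N.subgroupOf L)]
    (c : MonoidAlgebra R A) : MonoidAlgebra R A :=
  ∑ q : L ⧸ N.subgroupOf L,
    MonoidAlgebra.of R A (q.out : L) * c * MonoidAlgebra.of R A ((q.out : L) : A)⁻¹

theorem conj_eq_of_mk_eq {N L : Subgroup A} {c : MonoidAlgebra R A}
    (hc : ∀ n ∈ N, MonoidAlgebra.of R A n * c * MonoidAlgebra.of R A n⁻¹ = c) {u w : L}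
    (huw : (QuotientGroup.mk u : L ⧸ N.subgroupOf L) = QuotientGroup.mk w) :
    MonoidAlgebra.of R A (u : A) * c * MonoidAlgebra.of R A (u : A)⁻¹ =
      MonoidAlgebra.of R A (w : A) * c * MonoidAlgebra.of R A (w : A)⁻¹ := by
  have h1 : (u : A)⁻¹ * w ∈ N := Subgroup.mem_subgroupOf.mp (QuotientGroup.eq.mp huw)
  have h2 : (w : A) = u * ((u : A)⁻¹ * w) := by group
  rw [h2, ← conj_conj, hc _ h1]

theorem conj_conjSum {N L : Subgroup A} [Fintype (L ⧸ N.subgroupOf L)] {c : MonoidAlgebra R A}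
    (hc : ∀ x : MonoidAlgebra R N, Commute c (incl R N x)) (y : L) :
    MonoidAlgebra.of R A (y : A) * conjSum N L c * MonoidAlgebra.of R A (y : A)⁻¹ =
      conjSum N L c := by
  rw [commute_incl_iff] at hc
  unfold conjSum
  rw [Finset.mul_sum, Finset.sum_mul]
  refine Fintype.sum_bijective (fun q : L ⧸ N.subgroupOf L => y • q) (MulAction.bijective y) _ _
    fun q => ?_
  rw [conj_conj, ← Subgroup.coe_mul]
  refine conj_eq_of_mk_eq hc ?_
  rw [QuotientGroup.out_eq', ← smul_eq_mul, ← MulAction.Quotient.smul_mk, QuotientGroup.out_eq']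

theorem exists_central_incl_eq_conjSum {N L : Subgroup A} [N.Normal]
    [Fintype (L ⧸ N.subgroupOf L)] (hNL : N ≤ L) {g : A} (hg : g ∈ L)
    {c : MonoidAlgebra R A} (hc : c ∈ gradedPart R N g) :
    ∃ z : MonoidAlgebra R L, incl R L z = conjSum N L c ∧ ∀ y, y * z = z * y := by
  have h1 : ∀ q : L ⧸ N.subgroupOf L, ∃ y, incl R L y =
      MonoidAlgebra.of R A (q.out : L) * c * MonoidAlgebra.of R A ((q.out : L) : A)⁻¹ := fun q =>
    exists_incl_of_mem_gradedPart hNL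
      (L.mul_mem (L.mul_mem q.out.2 hg) (L.inv_mem q.out.2)) (gradedPart_conj hc _)
  choose y hy using h1
  have h2 : incl R L (∑ q, y q) = conjSum N L c := by
    rw [map_sum, conjSum]
    exact Finset.sum_congr rfl fun q _ => hy q
  refine ⟨∑ q, y q, h2, fun w => incl_injective L ?_⟩
  rw [map_mul, map_mul, h2]
  exact ((commute_incl_iff (N := L)).mpr (fun n hn => conj_conjSum hc.2 ⟨n, hn⟩) w).symm.eq

/-- Each of the `|L : N|` conjugates acts by the same scalar. -/
theorem ActsBy.conjSum {N L : Subgroup A} [Fintype (L ⧸ N.subgroupOf L)] (hLH : L ≤ H)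
    {ρ : Representation K H V} {c : MonoidAlgebra R A} {s : R} (hs : ActsBy ρ c s) :
    ActsBy ρ (conjSum N L c) (N.relIndex L * s) := by
  have := ActsBy.sum Finset.univ (fun q (_ : q ∈ (Finset.univ : Finset (L ⧸ N.subgroupOf L))) =>
    hs.conj (hLH q.out.2))
  rw [Finset.sum_const, nsmul_eq_mul, Finset.card_univ, ← Nat.card_eq_fintype_card] at this
  exact this

/-! ### The ratio character of two extensions -/

section Ratio

variable {W : Type*} [AddCommGroup W] [Module K W] [Nontrivial V] [Nontrivial W]
  [IsIntegrallyClosedIn R K] {k : Type*} [Field k] (red : R →+* k)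

/-- The linear character comparing two extensions to the ramification group of characters in the
same block. -/
theorem exists_ratio {N : Subgroup A} [N.Normal] (b : MonoidAlgebra R N)
    (hH : ∀ g ∈ H, ∃ c ∈ gradedPart R N g, ∃ d ∈ gradedPart R N g⁻¹,
      incl R N b * (c * d) = incl R N b ∧ incl R N b * (d * c) = incl R N b)
    (hNH : N ≤ H) [Finite H] {ρ : Representation K H V} {σ : Representation K H W}
    (hρ : HasScalarEnds (MonoidHom.comp ρ (Subgroup.inclusion hNH) : Representation K N V))
    (hσ : HasScalarEnds (MonoidHom.comp σ (Subgroup.inclusion hNH) : Representation K N W))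
    (hρb : ActsBy ρ (incl R N b) 1) (hσb : ActsBy σ (incl R N b) 1)
    (h1 : ∀ c ∈ gradedPart R N 1, ∀ s t, ActsBy ρ c s → ActsBy σ c t → red s = red t) :
    ∃ μ : H →* kˣ, (∀ g : H, ∀ c ∈ gradedPart R N (g : A), ∀ s t, ActsBy ρ c s → ActsBy σ c t →
        red t = μ g * red s) ∧
      ∀ g : H, ∃ c ∈ gradedPart R N (g : A), ∃ s, ActsBy ρ c s ∧ red s ≠ 0 := by
  have hex : ∀ {g : A}, g ∈ H → ∀ {c : MonoidAlgebra R A}, c ∈ gradedPart R N g →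
      (∃ s, ActsBy ρ c s) ∧ ∃ t, ActsBy σ c t := fun hg c hc =>
    ⟨exists_actsBy hNH hρ (exists_incl_of_mem_gradedPart hNH hg hc) hc.2,
      exists_actsBy hNH hσ (exists_incl_of_mem_gradedPart hNH hg hc) hc.2⟩
  -- the ratio at a single element
  have hratio : ∀ g : H, ∃ m : k, m ≠ 0 ∧ (∀ c ∈ gradedPart R N (g : A), ∀ s t, ActsBy ρ c s →
      ActsBy σ c t → red t = m * red s) ∧
      ∃ c ∈ gradedPart R N (g : A), ∃ s, ActsBy ρ c s ∧ red s ≠ 0 := by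
    intro g
    obtain ⟨c, hc, d, hd, hcd, hdc⟩ := hH g g.2
    obtain ⟨⟨sc, hsc⟩, tc, htc⟩ := hex g.2 hc
    obtain ⟨⟨sd, hsd⟩, td, htd⟩ := hex (inv_mem g.2) hd
    have hs : sc * sd = 1 := by
      have := hρb.mul (hsc.mul hsd)
      rw [hcd, one_mul] at this
      exact this.unique hρb
    have ht : td * tc = 1 := by
      have := hσb.mul (htd.mul htc)
      rw [hdc, one_mul] at this
      exact this.unique hσb
    have hs' : red sc * red sd = 1 := by rw [← map_mul, hs, map_one]
    have ht' : red td * red tc = 1 := by rw [← map_mul, ht, map_one]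
    -- Since `b` acts as the identity, `sc` and `sd` are mutually inverse, so this is the ratio of
    -- `tc` to `sc` in `k`. For another `c'` in degree `g`, the product `c' * d` has degree `1`,
    -- where both actions agree in `k`.
    refine ⟨red tc * red sd, mul_ne_zero (right_ne_zero_of_mul_eq_one ht')
      (right_ne_zero_of_mul_eq_one hs'), ?_, c, hc, sc, hsc, left_ne_zero_of_mul_eq_one hs'⟩
    intro c' hc' s t hs ht
    have hmem : c' * d ∈ gradedPart R N 1 := by
      have := gradedPart_mul hc' hd
      rwa [mul_inv_cancel] at this
    have := h1 _ hmem _ _ (hs.mul hsd) (ht.mul htd)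
    rw [map_mul, map_mul] at this
    calc red t = red t * (red td * red tc) := by rw [ht', mul_one]
      _ = (red t * red td) * red tc := by ring
      _ = red tc * red sd * red s := by rw [← this]; ring
  choose m hm0 hm hunit using hratio
  have hmul : ∀ g h : H, m (g * h) = m g * m h := by
    intro g h
    obtain ⟨c, hc, s, hs, hs0⟩ := hunit g
    obtain ⟨d, hd, s', hs', hs0'⟩ := hunit h
    obtain ⟨-, t, ht⟩ := hex g.2 hc
    obtain ⟨-, t', ht'⟩ := hex h.2 hd
    have h2 := hm (g * h) (c * d) (gradedPart_mul hc hd) _ _ (hs.mul hs') (ht.mul ht')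
    rw [map_mul, map_mul, hm g c hc s t hs ht, hm h d hd s' t' hs' ht'] at h2
    apply mul_right_cancel₀ (mul_ne_zero hs0 hs0')
    rw [← h2]
    ring
  have hone : m 1 = 1 := by
    have := hmul 1 1
    rw [mul_one] at this
    exact (mul_right_eq_self₀.mp this.symm).resolve_right (hm0 1)
  exact ⟨⟨⟨fun g => Units.mk0 (m g) (hm0 g), Units.ext hone⟩, fun g h => Units.ext (hmul g h)⟩,
    hm, hunit⟩

-- The conjugate sum of `c` is central in `R L` and acts by `|L : N| s` and `|L : N| t`. These are
-- congruent and the index is invertible in `k`, so `red s = red t = m * red s`.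
omit [Nontrivial V] [Nontrivial W] in
theorem ratio_eq_one_of_congr [Nontrivial W] {N L : Subgroup A} [N.Normal] [Finite A] (hNL : N ≤ L)
    (hLH : L ≤ H) {ρ : Representation K H V} {σ : Representation K H W}
    (hσ : HasScalarEnds (MonoidHom.comp σ (Subgroup.inclusion (hNL.trans hLH)) :
      Representation K N W))
    (hcard : (N.relIndex L : k) ≠ 0) {g : A} (hg : g ∈ L) {m : k}
    (hm : ∀ c ∈ gradedPart R N g, ∀ s t, ActsBy ρ c s → ActsBy σ c t → red t = m * red s)
    (hunit : ∃ c ∈ gradedPart R N g, ∃ s, ActsBy ρ c s ∧ red s ≠ 0)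
    (hcong : ∀ z : MonoidAlgebra R L, (∀ y, y * z = z * y) → ∀ s t, ActsBy ρ (incl R L z) s →
      ActsBy σ (incl R L z) t → red s = red t) : m = 1 := by
  have := Fintype.ofFinite (L ⧸ N.subgroupOf L)
  obtain ⟨c, hc, s, hs, hs0⟩ := hunit
  obtain ⟨t, ht⟩ := exists_actsBy (R := R) (hNL.trans hLH) hσ
    (exists_incl_of_mem_gradedPart (hNL.trans hLH) (hLH hg) hc) hc.2
  obtain ⟨z, hz, hzc⟩ := exists_central_incl_eq_conjSum hNL hg hc
  have h1 := hcong z hzc _ _ (hz ▸ hs.conjSum (N := N) hLH) (hz ▸ ht.conjSum (N := N) hLH)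
  rw [map_mul, map_mul, map_natCast, hm c hc s t hs ht] at h1
  have h2 := mul_left_cancel₀ hcard h1
  exact (mul_eq_right₀ hs0).mp h2.symm

-- As `ρ` is defined on `A`, both `c` and its conjugate under `a` act on it by the same `s`. On `σ`
-- the conjugate sum and its conjugate under `a` act by congruent scalars, which are `|L : N|` times
-- those of `c` and its conjugate.
omit [Nontrivial V] [Nontrivial W] in
theorem ratio_conj_eq_of_congr [Nontrivial W] {N L : Subgroup A} [N.Normal] [Finite A]
    (hNL : N ≤ L) (hLH : L ≤ H) {ρ : Representation K A V} {σ : Representation K H W}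
    (hσ : HasScalarEnds (MonoidHom.comp σ (Subgroup.inclusion (hNL.trans hLH)) :
      Representation K N W))
    (hcard : (N.relIndex L : k) ≠ 0) {a : A} (ha : ∀ x ∈ L, a * x * a⁻¹ ∈ L) {g : A} (hg : g ∈ L)
    {m m' : k}
    (hm : ∀ c ∈ gradedPart R N g, ∀ s t,
      ActsBy (MonoidHom.comp ρ H.subtype : Representation K H V) c s → ActsBy σ c t →
      red t = m * red s)
    (hm' : ∀ c ∈ gradedPart R N (a * g * a⁻¹), ∀ s t,
      ActsBy (MonoidHom.comp ρ H.subtype : Representation K H V) c s → ActsBy σ c t →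
      red t = m' * red s)
    (hunit : ∃ c ∈ gradedPart R N g, ∃ s,
      ActsBy (MonoidHom.comp ρ H.subtype : Representation K H V) c s ∧ red s ≠ 0)
    (hcong : ∀ z : MonoidAlgebra R L, (∀ y, y * z = z * y) → ∀ s t, ActsBy σ (incl R L z) s →
      ActsBy σ (MonoidAlgebra.of R A a * incl R L z * MonoidAlgebra.of R A a⁻¹) t →
      red s = red t) : m' = m := by
  have := Fintype.ofFinite (L ⧸ N.subgroupOf L)
  obtain ⟨c, hc, s, hs, hs0⟩ := hunit
  obtain ⟨t, ht⟩ := exists_actsBy (R := R) (hNL.trans hLH) hσ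
    (exists_incl_of_mem_gradedPart (hNL.trans hLH) (hLH hg) hc) hc.2
  have hc' := gradedPart_conj hc a
  have hex' := exists_incl_of_mem_gradedPart (hNL.trans hLH) (hLH (ha g hg)) hc'
  obtain ⟨t', ht'⟩ := exists_actsBy (R := R) (hNL.trans hLH) hσ hex' hc'.2
  have hs' := hs.conj_of_extension a hex'
  obtain ⟨z, hz, hzc⟩ := exists_central_incl_eq_conjSum hNL hg hc
  have hact : ActsBy σ (MonoidAlgebra.of R A a * conjSum N L c * MonoidAlgebra.of R A a⁻¹)
      (N.relIndex L * t') := by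
    have h1 := ActsBy.sum Finset.univ
      (fun q (_ : q ∈ (Finset.univ : Finset (L ⧸ N.subgroupOf L))) =>
        ht'.conj (hLH (ha _ q.out.2)))
    rw [Finset.sum_const, nsmul_eq_mul, Finset.card_univ, ← Nat.card_eq_fintype_card] at h1
    have h2 : MonoidAlgebra.of R A a * conjSum N L c * MonoidAlgebra.of R A a⁻¹ =
        ∑ q : L ⧸ N.subgroupOf L, MonoidAlgebra.of R A (a * (q.out : L) * a⁻¹) *
          (MonoidAlgebra.of R A a * c * MonoidAlgebra.of R A a⁻¹) *
          MonoidAlgebra.of R A (a * (q.out : L) * a⁻¹)⁻¹ := by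
      rw [conjSum, Finset.mul_sum, Finset.sum_mul]
      refine Finset.sum_congr rfl fun q _ => ?_
      rw [conj_conj, conj_conj, inv_mul_cancel_right]
    rw [h2]
    exact h1
  have h1 := hcong z hzc _ _ (hz ▸ ht.conjSum (N := N) hLH) (hz ▸ hact)
  rw [map_mul, map_mul, map_natCast, hm c hc s t hs ht, hm' _ hc' s t' hs' ht'] at h1
  exact (mul_right_cancel₀ hs0 (mul_left_cancel₀ hcard h1)).symm

end Ratio

end GradedAction

/-! ### Lifting and extending linear characters -/

section LinearCharacters

variable {R k : Type*} [CommRing R] [Field k]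

theorem hasEnoughRootsOfUnity_of_isIntegrallyClosedIn (R K : Type*) [CommRing R] [IsDomain R]
    [Field K] [Algebra R K] [IsIntegrallyClosedIn R K] (e : ℕ) [NeZero e]
    [HasEnoughRootsOfUnity K e] : HasEnoughRootsOfUnity R e where
  prim := by
    obtain ⟨ζ, hζ⟩ := HasEnoughRootsOfUnity.exists_primitiveRoot K e
    obtain ⟨hinj, hint⟩ := (isIntegrallyClosedIn_iff (R := R) (A := K)).mp inferInstance
    obtain ⟨y, rfl⟩ := hint (hζ.isIntegral (NeZero.pos e) |>.tower_top (A := R))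
    exact ⟨y, hζ.of_map_of_injective hinj⟩
  cyc := rootsOfUnity.isCyclic R e

theorem units_eq_one_of_pow_char_pow {ℓ : ℕ} [Fact ℓ.Prime] [CharP k ℓ] {u : kˣ} {n : ℕ}
    (h : u ^ ℓ ^ n = 1) : u = 1 := by
  ext
  have h1 : (u : k) ^ ℓ ^ n = 1 := by rw [← Units.val_pow_eq_pow_val, h, Units.val_one]
  have h2 : iterateFrobenius k ℓ n u = iterateFrobenius k ℓ n 1 := by
    rw [iterateFrobenius_def, h1, map_one]
  exact iterateFrobenius_inj k ℓ n h2

/-- Roots of unity of order prime to the characteristic lift uniquely. -/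
theorem restrictRootsOfUnity_bijective [IsDomain R] (red : R →+* k) {m : ℕ} [NeZero m]
    (hm : (m : k) ≠ 0) {ζ : R} (hζ : IsPrimitiveRoot ζ m) :
    Function.Bijective (restrictRootsOfUnity red m) := by
  have hζ' : IsPrimitiveRoot (red ζ) m := by
    obtain ⟨n, rfl⟩ := Nat.exists_eq_succ_of_ne_zero (NeZero.ne m)
    -- The product of the `1 - ζ ^ i` for `0 < i < m` is `m`, which is nonzero in `k`, so no such
    -- power of ζ reduces to `1`.
    have hprod := congrArg red hζ.prod_one_sub_pow_eq_order
    rw [map_prod] at hprod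
    refine IsPrimitiveRoot.mk_of_lt _ n.succ_pos ?_ fun l hl0 hl h => ?_
    · rw [← map_pow, hζ.pow_eq_one, map_one]
    · refine hm (?_ : ((n + 1 : ℕ) : k) = 0)
      push_cast
      have : ∏ i ∈ Finset.range n, red (1 - ζ ^ (i + 1)) = 0 := by
        refine Finset.prod_eq_zero (i := l - 1) (Finset.mem_range.mpr (by omega)) ?_
        rw [Nat.sub_add_cancel hl0, map_sub, map_pow, h, map_one, sub_self]
      rw [this] at hprod
      simpa using hprod.symm
  constructor
  · rw [injective_iff_map_eq_one]
    intro u hu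
    obtain ⟨i, hi, h⟩ := hζ.eq_pow_of_pow_eq_one (ξ := ((u : Rˣ) : R))
      (by rw [← Units.val_pow_eq_pow_val, (mem_rootsOfUnity m _).mp u.2, Units.val_one])
    have h1 : red ((u : Rˣ) : R) = 1 := by
      rw [← restrictRootsOfUnity_coe_apply, hu]
      rfl
    rw [← h, map_pow] at h1
    have h2 := hζ'.dvd_of_pow_eq_one _ h1
    ext
    rw [← h, Nat.eq_zero_of_dvd_of_lt h2 hi]
    simp
  · intro u
    obtain ⟨i, -, h⟩ := hζ'.eq_pow_of_pow_eq_one (ξ := ((u : kˣ) : k))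
      (by rw [← Units.val_pow_eq_pow_val, (mem_rootsOfUnity m _).mp u.2, Units.val_one])
    have hz : (hζ.isUnit (NeZero.ne m)).unit ∈ rootsOfUnity m R := by
      rw [mem_rootsOfUnity]
      ext
      simpa using hζ.pow_eq_one
    refine ⟨⟨_, hz⟩ ^ i, ?_⟩
    ext
    rw [restrictRootsOfUnity_coe_apply]
    simpa using h

/-- In characteristic ℓ the values are roots of unity of order dividing the ℓ'-part of `e`, and
these lift uniquely. The second clause lets triviality and invariance pass from `μ` to its lift. -/
theorem exists_units_lift [IsDomain R] (red : R →+* k) {ℓ : ℕ} [Fact ℓ.Prime] [CharP k ℓ] {e : ℕ}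
    [NeZero e] [HasEnoughRootsOfUnity R e] {H : Type*} [Group H] (μ : H →* kˣ)
    (hμ : ∀ h, μ h ^ e = 1) : ∃ ν : H →* Rˣ, (∀ h, red (ν h) = μ h) ∧
      ∀ h h', μ h = μ h' → ν h = ν h' := by
  obtain ⟨a, m, hm, hem⟩ := Nat.exists_eq_pow_mul_and_not_dvd (NeZero.ne e) ℓ
    (Fact.out : ℓ.Prime).ne_one
  have hm0 : (m : k) ≠ 0 := fun h => hm ((CharP.cast_eq_zero_iff k ℓ m).mp h)
  have : NeZero m := ⟨fun h => hm0 (by rw [h, Nat.cast_zero])⟩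
  obtain ⟨ζ, hζ⟩ := HasEnoughRootsOfUnity.exists_primitiveRoot R e
  let E := MulEquiv.ofBijective _
    (restrictRootsOfUnity_bijective red hm0 (hζ.pow (NeZero.pos e) hem))
  have hμm : ∀ h, μ h ∈ rootsOfUnity m k := fun h => by
    rw [mem_rootsOfUnity]
    refine units_eq_one_of_pow_char_pow (ℓ := ℓ) (n := a) ?_
    rw [← pow_mul, mul_comm, ← hem, hμ]
  refine ⟨((rootsOfUnity m R).subtype.comp E.symm.toMonoidHom).comp (μ.codRestrict _ hμm),
    fun h => ?_, fun h h' hh => ?_⟩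
  swap
  · have h1 : μ.codRestrict _ hμm h = μ.codRestrict _ hμm h' := Subtype.ext hh
    simp only [MonoidHom.comp_apply, h1]
  have h1 := E.apply_symm_apply (μ.codRestrict _ hμm h)
  have h2 := congrArg (fun u : rootsOfUnity m k => ((u : kˣ) : k)) h1
  exact h2

/-- The kernel of `μ / ν` is normal of index a divisor of a power of ℓ, and `kˣ` has no ℓ-torsion.
-/
theorem eq_of_eqOn_of_relIndex {ℓ : ℕ} [Fact ℓ.Prime] [CharP k ℓ] {G : Type*} [Group G]
    {I : Subgroup G} (hI : ∃ n, I.index = ℓ ^ n) {μ ν : G →* kˣ} (h : ∀ x ∈ I, μ x = ν x) :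
    μ = ν := by
  obtain ⟨n, hn⟩ := hI
  have hker : I ≤ (μ / ν).ker := fun x hx => by
    rw [MonoidHom.mem_ker, MonoidHom.div_apply, h x hx, div_self']
  ext1 x
  have h1 : (μ / ν) x ^ ℓ ^ n = 1 := by
    rw [← map_pow, ← MonoidHom.mem_ker, ← hn]
    obtain ⟨d, hd⟩ := Subgroup.index_dvd_of_le hker
    rw [hd, pow_mul]
    exact pow_mem (Subgroup.pow_index_mem _ x) d
  have h2 := units_eq_one_of_pow_char_pow h1
  rwa [MonoidHom.div_apply, div_eq_one] at h2

/-- A homomorphism from a subgroup of a finite group to the units of a domain with enough roots of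
unity extends to the whole group when it is trivial on commutators. -/
theorem exists_extension_of_commutator [IsDomain R] {G : Type*} [Group G] [Finite G]
    [HasEnoughRootsOfUnity R (Monoid.exponent G)] {B : Subgroup G} (ψ : B →* Rˣ)
    (hψ : ∀ x : B, (x : G) ∈ commutator G → ψ x = 1) : ∃ ν : G →* Rˣ, ∀ x : B, ν x = ψ x := by
  let f : B →* B.map (Abelianization.of (G := G)) := Abelianization.of.subgroupMap B
  have hf : Function.Surjective f := Abelianization.of.subgroupMap_surjective B
  have hker : f.ker ≤ ψ.ker := fun x hx => hψ x <| by
    have h1 := congrArg Subtype.val (MonoidHom.mem_ker.mp hx)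
    rw [← Abelianization.ker_of]
    exact h1
  have : Finite (Abelianization G) :=
    Finite.of_surjective Abelianization.of (QuotientGroup.mk'_surjective (commutator G))
  have : HasEnoughRootsOfUnity R (Monoid.exponent (Abelianization G)) :=
    HasEnoughRootsOfUnity.of_dvd R (n := Monoid.exponent G)
      (Group.exponent_quotient_dvd (commutator G))
  -- Linear characters of a subgroup of a finite abelian group extend when there are enough roots of
  -- unity.
  obtain ⟨θ, hθ⟩ := MonoidHom.domRestrict_surjective (M := R) (B.map (Abelianization.of (G := G)))
    (f.liftOfSurjective hf ⟨ψ, hker⟩)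
  refine ⟨θ.comp Abelianization.of, fun x => ?_⟩
  have h1 := DFunLike.congr_fun hθ (f x)
  have h2 : f.liftOfSurjective hf ⟨ψ, hker⟩ (f x) = ψ x :=
    MonoidHom.liftOfRightInverse_comp_apply f _ _ ⟨ψ, hker⟩ x
  exact h1.trans h2

/-- Descend `μ` to `IJ/J`. As `A = N_A(I) J`, every element of `A` acts on `A/J` like one of the
normalizer, so `IJ/J` is normal and the descended character is invariant. The hypothesis on
invariant characters makes it trivial on commutators. -/
theorem exists_extension_of_invLin [IsDomain R] {K : Type*} [Field K] [Algebra R K]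
    (hRK : Function.Injective (algebraMap R K)) {A : Type*} [Group A] [Finite A]
    [HasEnoughRootsOfUnity R (Monoid.exponent A)] {I J : Subgroup A} [J.Normal]
    (hlin : ∀ (H : Subgroup (A ⧸ J)) [H.Normal],
      H ≤ (commutator A ⊔ J).map (QuotientGroup.mk' J) →
        invLin K ((MulAut.conjNormal (H := H)).comp (QuotientGroup.mk' J)) = {1})
    (hIJ : ∀ a : A, ∃ n ∈ Subgroup.normalizer (I : Set A), ∃ j ∈ J, a = n * j)
    (μ : I →* Rˣ) (hμJ : ∀ x : I, (x : A) ∈ J → μ x = 1)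
    (hμ : ∀ a ∈ Subgroup.normalizer (I : Set A), ∀ x y : I, (y : A) = a * x * a⁻¹ → μ y = μ x) :
    ∃ ν : A →* Rˣ, (∀ x ∈ J, ν x = 1) ∧ ∀ x : I, ν x = μ x := by
  let p := QuotientGroup.mk' J
  let f : I →* I.map p := p.subgroupMap I
  have hf : Function.Surjective f := p.subgroupMap_surjective I
  have hker : f.ker ≤ μ.ker := fun x hx => hμJ x <| by
    have h1 := congrArg Subtype.val (MonoidHom.mem_ker.mp hx)
    exact (QuotientGroup.eq_one_iff (N := J) (x : A)).mp h1
  let ψ : I.map p →* Rˣ := f.liftOfSurjective hf ⟨μ, hker⟩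
  have hψ : ∀ x : I, ψ (f x) = μ x := fun x =>
    MonoidHom.liftOfRightInverse_comp_apply f _ _ ⟨μ, hker⟩ x
  have hp : ∀ a : A, ∃ n ∈ Subgroup.normalizer (I : Set A), p a = p n := by
    intro a
    obtain ⟨n, hn, j, hj, rfl⟩ := hIJ a
    refine ⟨n, hn, ?_⟩
    have : p j = 1 := (QuotientGroup.eq_one_iff (N := J) j).mpr hj
    rw [map_mul, this, mul_one]
  have hconj : ∀ n ∈ Subgroup.normalizer (I : Set A), ∀ x : I, n * x * n⁻¹ ∈ I := fun n hn x =>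
    (Subgroup.mem_normalizer_iff.mp hn x).mp x.2
  have hpsi : ∀ (a : A) (x y : I.map p), (y : A ⧸ J) = p a * x * (p a)⁻¹ → ψ y = ψ x := by
    intro a x y hxy
    obtain ⟨n, hn, hna⟩ := hp a
    obtain ⟨x, rfl⟩ := hf x
    have hy : y = f ⟨n * x * n⁻¹, hconj n hn x⟩ := by
      ext1
      rw [hxy, hna]
      simp [f]
    rw [hy, hψ, hψ]
    exact hμ n hn _ _ rfl
  have hnormal : (I.map p).Normal := by
    refine ⟨fun x hx g => ?_⟩
    obtain ⟨x, hx, rfl⟩ := hx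
    obtain ⟨a, rfl⟩ := QuotientGroup.mk'_surjective J g
    obtain ⟨n, hn, hna⟩ := hp a
    refine ⟨n * x * n⁻¹, hconj n hn ⟨x, hx⟩, ?_⟩
    change p _ = p a * p x * (p a)⁻¹
    rw [hna, map_mul, map_mul, map_inv]
  have hcomm : commutator (A ⧸ J) = (commutator A).map p := by
    rw [commutator_def, commutator_def, Subgroup.map_commutator, ← MonoidHom.range_eq_map,
      MonoidHom.range_eq_top.mpr (QuotientGroup.mk'_surjective J)]
  -- This intersection is the only subgroup to which `hlin` is applied.
  let H := I.map p ⊓ commutator (A ⧸ J)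
  have hH := hlin H (inf_le_right.trans (by
    rw [hcomm, Subgroup.map_sup]
    exact le_sup_left))
  have hmem : (Units.map (algebraMap R K).toMonoidHom).comp
      (ψ.comp (Subgroup.inclusion (inf_le_left : H ≤ I.map p))) ∈
      invLin K ((MulAut.conjNormal (H := H)).comp (QuotientGroup.mk' J)) := by
    intro a h
    have := hpsi a (Subgroup.inclusion (inf_le_left : H ≤ I.map p) h)
      (Subgroup.inclusion (inf_le_left : H ≤ I.map p)
        (((MulAut.conjNormal (H := H)).comp (QuotientGroup.mk' J)) a h)) rfl
    simp only [MonoidHom.comp_apply] at this ⊢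
    rw [this]
  rw [hH, Set.mem_singleton_iff] at hmem
  have hcommψ : ∀ x : I.map p, (x : A ⧸ J) ∈ commutator (A ⧸ J) → ψ x = 1 := by
    intro x hx
    have h1 := DFunLike.congr_fun hmem ⟨x, x.2, hx⟩
    ext
    apply hRK
    rw [Units.val_one, map_one]
    exact congrArg Units.val h1
  have : HasEnoughRootsOfUnity R (Monoid.exponent (A ⧸ J)) :=
    HasEnoughRootsOfUnity.of_dvd R (n := Monoid.exponent A) (Group.exponent_quotient_dvd J)
  obtain ⟨ν, hν⟩ := exists_extension_of_commutator ψ hcommψ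
  refine ⟨ν.comp p, fun x hx => ?_, fun x => (hν (f x)).trans (hψ x)⟩
  have : p x = 1 := (QuotientGroup.eq_one_iff (N := J) x).mpr hx
  rw [MonoidHom.comp_apply, this, map_one]

end LinearCharacters

/-! ### Twisting by linear characters -/

section Twist

variable {K R G : Type*} [Field K] [CommRing R] [Algebra R K] [Group G] {V : Type*}
  [AddCommGroup V] [Module K V]

/-- The tensor product of a representation with a linear character. -/
def Representation.twist (ν : G →* Rˣ) (ρ : Representation K G V) : Representation K G V where
  toFun g := algebraMap R K (ν g) • ρ g
  map_one' := by simp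
  map_mul' g h := by
    rw [map_mul, map_mul, Units.val_mul, map_mul, smul_mul_smul_comm]

theorem Representation.twist_apply (ν : G →* Rˣ) (ρ : Representation K G V) (g : G) :
    ρ.twist ν g = algebraMap R K (ν g) • ρ g := rfl

theorem repAct_twist (ν : G →* Rˣ) (ρ : Representation K G V) {r : R} {x : MonoidAlgebra R G}
    (hx : ∀ g, x.coeff g ≠ 0 → (ν g : R) = r) :
    repAct R (ρ.twist ν) x = algebraMap R K r • repAct R ρ x := by
  have hsum : x = ∑ g ∈ x.coeff.support, MonoidAlgebra.single g (x.coeff g) := by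
    apply MonoidAlgebra.coeff_injective
    conv_lhs => rw [← Finsupp.sum_single x.coeff]
    rw [MonoidAlgebra.coeff_sum, Finsupp.sum]
    rfl
  rw [hsum, map_sum, map_sum, Finset.smul_sum]
  refine Finset.sum_congr rfl fun g hg => ?_
  rw [repAct_single, repAct_single, twist_apply, hx g (Finsupp.mem_support_iff.mp hg), smul_smul,
    smul_smul, mul_comm]

theorem HasScalarEnds.of_comp {L : Type*} [Group L] {ρ : Representation K G V} (i : L →* G)
    (h : HasScalarEnds (MonoidHom.comp ρ i : Representation K L V)) : HasScalarEnds ρ :=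
  fun f hf => h f fun g v => hf (i g) v

theorem congr_of_sameBlock [CharZero K] [IsIntegrallyClosedIn R K] [Finite G] {R₀ : Type*}
    [CommRing R₀] [IsNoetherianRing R₀] [Algebra R₀ R] [Module.Finite R₀ R]
    (𝔞 : Ideal R₀) [IsAdicComplete 𝔞 R₀] [Finite (R₀ ⧸ 𝔞)] {k : Type*} [Field k]
    (red : R →+* k) (hred : ∀ r ∈ 𝔞, red (algebraMap R₀ R r) = 0) {W : Type*} [AddCommGroup W]
    [Module K W] [FiniteDimensional K V] [FiniteDimensional K W] [Nontrivial V] [Nontrivial W]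
    {ρ : Representation K G V} {σ : Representation K G W} (hρ : HasScalarEnds ρ)
    (hσ : HasScalarEnds σ) (h : SameBlock R ρ.character σ.character) {z : MonoidAlgebra R G}
    (hz : ∀ y, y * z = z * y) {s t : R} (hs : ∀ v, repAct R ρ z v = algebraMap R K s • v)
    (ht : ∀ v, repAct R σ z v = algebraMap R K t • v) : red s = red t := by
  obtain ⟨e, he, h1, h2⟩ := h
  exact centralCharacter_congr 𝔞 red hred hρ hσ he
    (repAct_eq_one_of_evalAlg ρ hρ he.central h1.2) (repAct_eq_one_of_evalAlg σ hσ he.central h2.2)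
    hz hs ht

end Twist

/-! ### Homogeneous decomposition of central elements -/

section Decomposition

variable {K R A : Type*} [Field K] [CommRing R] [Algebra R K] [Group A]

/-- Cut `c` along the cosets of `N`. Conjugation by `N` preserves each coset, so every piece still
commutes with `R N`. -/
theorem exists_sum_gradedPart {N L : Subgroup A} [N.Normal] [Fintype (L ⧸ N.subgroupOf L)]
    {c : MonoidAlgebra R A} (hcL : ∀ x, c.coeff x ≠ 0 → x ∈ L)
    (hc : ∀ x : MonoidAlgebra R N, Commute c (incl R N x)) :
    ∃ d : L ⧸ N.subgroupOf L → MonoidAlgebra R A, ∑ q, d q = c ∧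
      ∀ q, d q ∈ gradedPart R N ((q.out : L) : A) := by
  classical
  refine ⟨fun q => MonoidAlgebra.ofCoeff (c.coeff.filter fun x => x * ((q.out : L) : A)⁻¹ ∈ N),
    ?_, fun q => ⟨fun x hx => ?_, ?_⟩⟩
  · apply MonoidAlgebra.coeff_injective
    ext x
    rw [MonoidAlgebra.coeff_sum, Finsupp.finsetSum_apply]
    by_cases hx : c.coeff x = 0
    · rw [hx]
      refine Finset.sum_eq_zero fun q _ => ?_
      rw [MonoidAlgebra.coeff_ofCoeff, Finsupp.filter_apply, hx, ite_self]
    · rw [Finset.sum_eq_single (QuotientGroup.mk (⟨x, hcL x hx⟩ : L))]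
      · rw [MonoidAlgebra.coeff_ofCoeff, Finsupp.filter_apply, if_pos]
        have h1 : (QuotientGroup.mk (QuotientGroup.mk (⟨x, hcL x hx⟩ : L) :
          L ⧸ N.subgroupOf L).out : L ⧸ N.subgroupOf L) = QuotientGroup.mk ⟨x, hcL x hx⟩ :=
          QuotientGroup.out_eq' _
        have h2 := Subgroup.mem_subgroupOf.mp (QuotientGroup.eq.mp h1)
        exact ‹N.Normal›.mem_comm h2
      · intro q _ hq
        rw [MonoidAlgebra.coeff_ofCoeff, Finsupp.filter_apply, if_neg]
        intro h1
        apply hq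
        rw [← QuotientGroup.out_eq' q]
        exact QuotientGroup.eq.mpr (Subgroup.mem_subgroupOf.mpr (‹N.Normal›.mem_comm h1))
      · simp
  · rw [MonoidAlgebra.coeff_ofCoeff, Finsupp.filter_apply] at hx
    by_contra h
    exact hx (if_neg h)
  · rw [commute_incl_iff] at hc ⊢
    intro n hn
    apply MonoidAlgebra.coeff_injective
    ext x
    rw [coeff_conj, MonoidAlgebra.coeff_ofCoeff, Finsupp.filter_apply, Finsupp.filter_apply]
    have h1 : c.coeff (n⁻¹ * x * n) = c.coeff x := by rw [← coeff_conj, hc n hn]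
    have h2 : n⁻¹ * x * n * ((q.out : L) : A)⁻¹ ∈ N ↔ x * ((q.out : L) : A)⁻¹ ∈ N := by
      rw [mul_assoc, mul_assoc, Subgroup.mul_mem_cancel_left _ (N.inv_mem hn)]
      rw [‹N.Normal›.mem_comm_iff, mul_assoc, Subgroup.mul_mem_cancel_left _ hn,
        ‹N.Normal›.mem_comm_iff]
    rw [h1]
    exact if_congr h2 rfl rfl

variable {H : Subgroup A} {V W : Type*} [AddCommGroup V] [Module K V] [AddCommGroup W] [Module K W]

/-- `ν` is constant on the coset `N g` that supports `c`. -/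
theorem ActsBy.twist {N : Subgroup A} {ν : A →* Rˣ} (hν : ∀ x ∈ N, ν x = 1)
    {ρ : Representation K H V} {g : A} {c : MonoidAlgebra R A} (hc : c ∈ gradedPart R N g) {s : R}
    (hs : ActsBy ρ c s) : ActsBy (ρ.twist (ν.comp H.subtype)) c (ν g * s) := by
  obtain ⟨x, rfl, hs⟩ := hs
  refine ⟨x, rfl, fun v => ?_⟩
  rw [repAct_twist (r := (ν g : R)), LinearMap.smul_apply, hs, smul_smul, map_mul]
  intro h hh
  have h1 : (incl R H x).coeff h ≠ 0 := by
    rw [incl, MonoidAlgebra.mapDomainRingHom_apply, MonoidAlgebra.coeff_mapDomain,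
      ← H.subtype_apply h, Finsupp.mapDomain_apply H.subtype_injective]
    exact hh
  have h2 := hν _ (hc.1 _ h1)
  rw [map_mul, map_inv, mul_inv_eq_one] at h2
  exact congrArg Units.val h2

/-- After twisting by a lift of the ratio character, central characters become congruent. -/
theorem congr_twist_of_ratio [Nontrivial V] [Nontrivial W] [IsIntegrallyClosedIn R K] [Finite A]
    {k : Type*} [Field k] (red : R →+* k) {N L : Subgroup A} [N.Normal] (hNL : N ≤ L)
    (hLH : L ≤ H) {ρ : Representation K H V} {σ : Representation K H W}
    (hρ : HasScalarEnds (MonoidHom.comp ρ (Subgroup.inclusion (hNL.trans hLH)) :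
      Representation K N V))
    (hσ : HasScalarEnds (MonoidHom.comp σ (Subgroup.inclusion (hNL.trans hLH)) :
      Representation K N W))
    {ν : A →* Rˣ} (hν : ∀ x ∈ N, ν x = 1)
    (hm : ∀ g ∈ H, ∀ c ∈ gradedPart R N g, ∀ s t, ActsBy ρ c s → ActsBy σ c t →
      red t = red (ν g) * red s)
    {z : MonoidAlgebra R L} (hz : ∀ y, y * z = z * y) {s t : R}
    (hs : ActsBy (ρ.twist (ν.comp H.subtype)) (incl R L z) s) (ht : ActsBy σ (incl R L z) t) :
    red s = red t := by
  have := Fintype.ofFinite (L ⧸ N.subgroupOf L)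
  have hzN : ∀ x : MonoidAlgebra R N, Commute (incl R L z) (incl R N x) := fun x => by
    rw [← incl_inclusion hNL]
    have := congrArg (incl R L) (hz (MonoidAlgebra.mapDomainRingHom R (Subgroup.inclusion hNL) x))
    rw [map_mul, map_mul] at this
    exact this.symm
  have hzL : ∀ x, (incl R L z).coeff x ≠ 0 → x ∈ L := fun x hx => by
    rw [incl, MonoidAlgebra.mapDomainRingHom_apply, MonoidAlgebra.coeff_mapDomain] at hx
    by_contra h
    exact hx (Finsupp.mapDomain_of_notMem_range _ _ fun ⟨y, hy⟩ => h (hy ▸ y.2))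
  obtain ⟨d, hd, hdg⟩ := exists_sum_gradedPart hzL hzN
  have hmem : ∀ q : L ⧸ N.subgroupOf L, ((q.out : L) : A) ∈ H := fun q => hLH q.out.2
  have h1 : ∀ q, ∃ s : R, ActsBy ρ (d q) s := fun q =>
    exists_actsBy (hNL.trans hLH) hρ (exists_incl_of_mem_gradedPart (hNL.trans hLH) (hmem q)
      (hdg q)) (hdg q).2
  have h2 : ∀ q, ∃ t : R, ActsBy σ (d q) t := fun q =>
    exists_actsBy (hNL.trans hLH) hσ (exists_incl_of_mem_gradedPart (hNL.trans hLH) (hmem q)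
      (hdg q)) (hdg q).2
  choose s' hs' using h1
  choose t' ht' using h2
  have h3 := ActsBy.sum Finset.univ fun q (_ : q ∈ Finset.univ) => (hs' q).twist hν (hdg q)
  have h4 := ActsBy.sum Finset.univ fun q (_ : q ∈ Finset.univ) => ht' q
  rw [hd] at h3 h4
  rw [hs.unique h3, ht.unique h4, map_sum, map_sum]
  refine Finset.sum_congr rfl fun q _ => ?_
  rw [map_mul, hm _ (hmem q) _ (hdg q) _ _ (hs' q) (ht' q)]

end Decomposition

/-! ### Construction of the extension -/

section Main

variable {K R : Type*} [Field K] [CommRing R] [Algebra R K] {A : Type*} [Group A]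

theorem exists_conjHom {I : Subgroup A} {a : A} (ha : ∀ x ∈ I, a * x * a⁻¹ ∈ I) :
    ∃ f : I →* I, (∀ x, (f x : A) = a * x * a⁻¹) ∧ ∀ z : MonoidAlgebra R I,
      incl R I (MonoidAlgebra.mapDomainRingHom R f z) =
        MonoidAlgebra.of R A a * incl R I z * MonoidAlgebra.of R A a⁻¹ := by
  refine ⟨((MulAut.conj a).toMonoidHom.comp I.subtype).codRestrict I fun x => ha x x.2,
    fun x => rfl, fun z => ?_⟩
  induction z using MonoidAlgebra.induction_linear with
  | zero => simp
  | add x y hx hy => rw [map_add, map_add, map_add, hx, hy, mul_add, add_mul]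
  | single g r => simp

variable [CharZero K] [IsIntegrallyClosedIn R K] [Finite A] {R₀ : Type*}
  [CommRing R₀] [IsNoetherianRing R₀] [Algebra R₀ R] [Module.Finite R₀ R]
  (𝔞 : Ideal R₀) [IsAdicComplete 𝔞 R₀] [Finite (R₀ ⧸ 𝔞)] {k : Type*} [Field k]
  (red : R →+* k) (hred : ∀ r ∈ 𝔞, red (algebraMap R₀ R r) = 0)

include hred

/-- The restriction of `σ` to `I` and its conjugate under `a` both lie in the block `e`, because `e`
is fixed by `a`; their central characters are therefore congruent. -/
theorem congr_conj_of_blockStable {I H M : Subgroup A} (hIH : I ≤ H) {W : Type*} [AddCommGroup W]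
    [Module K W] [FiniteDimensional K W] [Nontrivial W] {σ : Representation K H W}
    (hσ : HasScalarEnds (MonoidHom.comp σ (Subgroup.inclusion hIH) : Representation K I W))
    (hM : M ≤ Subgroup.normalizer (I : Set A))
    (hstab : BlockStable R (Representation.character
      (MonoidHom.comp σ (Subgroup.inclusion hIH) : Representation K I W)) M) {a : A} (ha : a ∈ M)
    {z : MonoidAlgebra R I} (hz : ∀ y, y * z = z * y) {s t : R} (hs : ActsBy σ (incl R I z) s)
    (ht : ActsBy σ (MonoidAlgebra.of R A a * incl R I z * MonoidAlgebra.of R A a⁻¹) t) :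
    red s = red t := by
  obtain ⟨e, he, hmem, hinv⟩ := hstab
  have haI : ∀ x, x ∈ I ↔ a * x * a⁻¹ ∈ I := Subgroup.mem_normalizer_iff.mp (hM ha)
  obtain ⟨f, hf, hfz⟩ := exists_conjHom (R := R) fun x hx => (haI x).mp hx
  have hsurj : Function.Surjective f := fun y =>
    ⟨⟨a⁻¹ * y * a, (haI _).mpr (by convert! y.2 using 1; group)⟩, by
      ext
      rw [hf]
      group⟩
  let τ : Representation K I W := MonoidHom.comp σ (Subgroup.inclusion hIH)
  have hτ : HasScalarEnds (MonoidHom.comp τ f : Representation K I W) := fun u hu => hσ u (by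
    intro y v
    obtain ⟨x, rfl⟩ := hsurj y
    exact hu x v)
  have he1 : repAct R τ e = 1 := repAct_eq_one_of_evalAlg τ hσ he.central hmem.2
  have he2 : repAct R (MonoidHom.comp τ f : Representation K I W) e = 1 := by
    have h1 : MonoidAlgebra.mapDomainRingHom R f e = e := incl_injective I (by
      rw [hfz, hinv a ha])
    rw [repAct_comp, h1, he1]
  refine centralCharacter_congr 𝔞 red hred hσ hτ he he1 he2 hz
    ((actsBy_incl_iff hIH).mp hs) ?_
  rw [repAct_comp]
  rw [← hfz] at ht
  exact (actsBy_incl_iff hIH).mp ht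

theorem exists_linear_of_sameBlock [IsDomain R] {ℓ : ℕ} [Fact ℓ.Prime] [CharP k ℓ]
    [HasEnoughRootsOfUnity K (Monoid.exponent A)] {N J I H : Subgroup A} [N.Normal] [J.Normal]
    (hNJ : N ≤ J)
    (hlin : ∀ (H : Subgroup (A ⧸ J)) [H.Normal],
      H ≤ (commutator A ⊔ J).map (QuotientGroup.mk' J) →
        invLin K ((MulAut.conjNormal (H := H)).comp (QuotientGroup.mk' J)) = {1})
    {b : MonoidAlgebra R N} (hb : IsBlock b)
    (hH : ∀ g ∈ H, ∃ c ∈ gradedPart R N g, ∃ d ∈ gradedPart R N g⁻¹,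
      incl R N b * (c * d) = incl R N b ∧ incl R N b * (d * c) = incl R N b)
    (hNH : N ≤ H) (hI : IsHallCompl ℓ N I H)
    (hIJ : ∀ a : A, ∃ n ∈ Subgroup.normalizer (I : Set A), ∃ j ∈ J, a = n * j)
    {V W : Type*} [AddCommGroup V] [Module K V] [FiniteDimensional K V] [Nontrivial V]
    [AddCommGroup W] [Module K W] [FiniteDimensional K W] [Nontrivial W]
    {ρ : Representation K A V} {σ : Representation K H W}
    (hρN : HasScalarEnds (MonoidHom.comp ρ N.subtype : Representation K N V))
    (hσN : HasScalarEnds (MonoidHom.comp σ (Subgroup.inclusion hNH) : Representation K N W))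
    (hρb : repAct R (MonoidHom.comp ρ N.subtype : Representation K N V) b = 1)
    (hσb : repAct R (MonoidHom.comp σ (Subgroup.inclusion hNH) : Representation K N W) b = 1)
    (hJ : ∀ (L : Subgroup A) (_ : N ≤ L) (_ : L ≤ J) (h : L ≤ H), SameBlock R
      (Representation.character (MonoidHom.comp ρ L.subtype : Representation K L V))
      (Representation.character
        (MonoidHom.comp σ (Subgroup.inclusion h) : Representation K L W)))
    (hstab : BlockStable R (Representation.character (MonoidHom.comp σ
      (Subgroup.inclusion hI.le_right) : Representation K I W)) (Subgroup.normalizer (I : Set A))) :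
    ∃ ν : A →* Rˣ, (∀ x ∈ J, ν x = 1) ∧ ∀ g ∈ H, ∀ c ∈ gradedPart R N g, ∀ s t,
      ActsBy (MonoidHom.comp ρ H.subtype : Representation K H V) c s → ActsBy σ c t →
      red t = red (ν g) * red s := by
  have : NeZero (Monoid.exponent A) := ⟨Monoid.exponent_ne_zero_of_finite⟩
  have hRA := hasEnoughRootsOfUnity_of_isIntegrallyClosedIn R K (Monoid.exponent A)
  let ρH : Representation K H V := MonoidHom.comp ρ H.subtype
  -- The component of degree `1` is the centre of `R N`, where the common block `b` gives the
  -- congruence.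
  have h1 : ∀ c ∈ gradedPart R N 1, ∀ s t, ActsBy ρH c s → ActsBy σ c t → red s = red t := by
    intro c hc s t hs ht
    obtain ⟨z, rfl⟩ := exists_incl_of_mem_gradedPart le_rfl N.one_mem hc
    have hz : ∀ y, y * z = z * y := fun y => incl_injective N (by
      rw [map_mul, map_mul]
      exact (hc.2 y).symm.eq)
    have hs' := (actsBy_incl_iff (ρ := ρH) hNH).mp hs
    have ht' := (actsBy_incl_iff (ρ := σ) hNH).mp ht
    exact centralCharacter_congr 𝔞 red hred hρN hσN hb hρb hσb hz hs' ht'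
  obtain ⟨μ, hμ, hunit⟩ := exists_ratio (H := H) (ρ := ρH) red b hH hNH hρN hσN
    ((actsBy_incl_iff hNH).mpr fun v => by
      rw [map_one, one_smul]
      exact LinearMap.congr_fun hρb v)
    ((actsBy_incl_iff hNH).mpr fun v => by rw [hσb, map_one, one_smul, Module.End.one_apply]) h1
  -- triviality on `I ∩ J` and invariance under the normalizer of `I`
  have hcard : ∀ {L : Subgroup A}, N ≤ L → L ≤ I → (N.relIndex L : k) ≠ 0 := by
    intro L hNL hLI h
    have h2 := (CharP.cast_eq_zero_iff k ℓ _).mp h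
    have h3 : ℓ ∣ N.relIndex I :=
      h2.trans (Dvd.intro _ (Subgroup.relIndex_mul_relIndex N L I hNL hLI))
    exact (Nat.Prime.coprime_iff_not_dvd Fact.out).mp hI.coprime.symm h3
  have hμJ : ∀ g : H, (g : A) ∈ I → (g : A) ∈ J → μ g = 1 := by
    intro g hgI hgJ
    have hNL : N ≤ I ⊓ J := le_inf hI.le_left hNJ
    have hLH : I ⊓ J ≤ H := inf_le_left.trans hI.le_right
    ext
    refine ratio_eq_one_of_congr red hNL hLH hσN (hcard hNL inf_le_left) (g := g) ⟨hgI, hgJ⟩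
      (hμ g) (hunit g) fun z hz s t hs ht => ?_
    have hs' := (actsBy_incl_iff (ρ := ρH) hLH).mp hs
    have ht' := (actsBy_incl_iff (ρ := σ) hLH).mp ht
    have hρL : HasScalarEnds (MonoidHom.comp ρH (Subgroup.inclusion hLH) :
      Representation K ↥(I ⊓ J) V) := HasScalarEnds.of_comp (Subgroup.inclusion hNL) hρN
    have hσL : HasScalarEnds (MonoidHom.comp σ (Subgroup.inclusion hLH) :
      Representation K ↥(I ⊓ J) W) := HasScalarEnds.of_comp (Subgroup.inclusion hNL) hσN
    exact congr_of_sameBlock 𝔞 red hred hρL hσL (hJ _ hNL inf_le_right hLH) hz hs' ht'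
  have hμconj : ∀ a ∈ Subgroup.normalizer (I : Set A), ∀ g h : H, (g : A) ∈ I →
      (h : A) = a * g * a⁻¹ → μ h = μ g := by
    intro a ha g h hg hgh
    ext
    refine ratio_conj_eq_of_congr red hI.le_left hI.le_right hσN (hcard hI.le_left le_rfl) (a := a)
      (fun x => (Subgroup.mem_normalizer_iff.mp ha x).mp) hg (hμ g)
      (fun c hc => hμ h c (by rwa [hgh])) (hunit g) fun z hz s t hs ht => ?_
    have hσI : HasScalarEnds (MonoidHom.comp σ (Subgroup.inclusion hI.le_right) :
      Representation K I W) := HasScalarEnds.of_comp (Subgroup.inclusion hI.le_left) hσN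
    exact congr_conj_of_blockStable 𝔞 red hred hI.le_right hσI le_rfl hstab ha hz hs ht
  -- the lift to characteristic zero and its extension to `A`
  obtain ⟨ν', hν', hνeq⟩ := exists_units_lift red (ℓ := ℓ) (e := Monoid.exponent A)
    (μ.comp (Subgroup.inclusion hI.le_right)) (fun h => by
      have h2 : h ^ Monoid.exponent A = 1 := Subtype.ext (Monoid.pow_exponent_eq_one (h : A))
      rw [← map_pow, h2, map_one])
  obtain ⟨ν, hνJ, hνI⟩ := exists_extension_of_invLin
    ((isIntegrallyClosedIn_iff (R := R) (A := K)).mp inferInstance).1 hlin hIJ ν'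
    (fun x hx => by
      rw [← map_one ν']
      refine hνeq _ _ ?_
      rw [map_one]
      exact hμJ _ x.2 hx)
    (fun a ha x y hxy => hνeq _ _ (hμconj a ha _ _ x.2 hxy))
  -- Agreement on `I` suffices, since `I` has ℓ-power index in `H`.
  have hνμ : (Units.map red.toMonoidHom).comp (ν.comp H.subtype) = μ := by
    refine eq_of_eqOn_of_relIndex (ℓ := ℓ) (I := I.subgroupOf H) hI.index fun x hx => ?_
    ext
    have h3 := hν' ⟨x, Subgroup.mem_subgroupOf.mp hx⟩
    rw [← hνI] at h3
    exact h3
  refine ⟨ν, hνJ, fun g hg c hc s t hs ht => ?_⟩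
  rw [hμ ⟨g, hg⟩ c hc s t hs ht, ← hνμ]
  rfl

omit hred in
-- Membership in the block provides only some irreducible representation with the same character;
-- scalar endomorphisms transfer from it to `ρ`.
theorem hasScalarEnds_of_memIrrBlock {G : Type*} [Group G] [Finite G] {e : ℕ} [NeZero e]
    [HasEnoughRootsOfUnity K e] (hG : ∀ g : G, g ^ e = 1) {b : MonoidAlgebra R G} (hb : IsBlock b)
    {V : Type*} [AddCommGroup V] [Module K V] [FiniteDimensional K V] [Nontrivial V]
    {ρ : Representation K G V} (h : MemIrrBlock ρ.character b) :
    HasScalarEnds ρ ∧ repAct R ρ b = 1 := by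
  have hρ : HasScalarEnds ρ := by
    obtain ⟨n₀, ρ₀, hρ₀, h₀⟩ := h.1
    have := ((Representation.isIrreducible_iff_forall ρ₀).mp hρ₀).1
    exact HasScalarEnds.of_character_eq h₀.symm (hρ₀.hasScalarEnds hG)
  exact ⟨hρ, repAct_eq_one_of_evalAlg ρ hρ hb.central h.2⟩

omit hred [CharZero K] in
theorem neZero_of_isIrreducible {G : Type*} [Group G] {n : ℕ} {ρ : Representation K G (Fin n → K)}
    (hρ : ρ.IsIrreducible) : NeZero n := by
  have h := ((Representation.isIrreducible_iff_forall ρ).mp hρ).1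
  exact ⟨fun h0 => by subst h0; exact not_subsingleton (Fin 0 → K) inferInstance⟩

theorem exists_isIrrChar_sameBlock [IsDomain R] {ℓ : ℕ} [Fact ℓ.Prime] [CharP k ℓ]
    [HasEnoughRootsOfUnity K (Monoid.exponent A)] {N J I H : Subgroup A} [N.Normal] [J.Normal]
    (hNJ : N ≤ J)
    (hlin : ∀ (H : Subgroup (A ⧸ J)) [H.Normal],
      H ≤ (commutator A ⊔ J).map (QuotientGroup.mk' J) →
        invLin K ((MulAut.conjNormal (H := H)).comp (QuotientGroup.mk' J)) = {1})
    {b : MonoidAlgebra R N} (hb : IsBlock b)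
    (hH : ∀ g ∈ H, ∃ c ∈ gradedPart R N g, ∃ d ∈ gradedPart R N g⁻¹,
      incl R N b * (c * d) = incl R N b ∧ incl R N b * (d * c) = incl R N b)
    (hNH : N ≤ H) (hI : IsHallCompl ℓ N I H)
    (hIJ : ∀ a : A, ∃ n ∈ Subgroup.normalizer (I : Set A), ∃ j ∈ J, a = n * j)
    {χ' : A → K} (hχ' : IsIrrChar χ') (hχ : MemIrrBlock (resTop N χ') b)
    {φ' : H → K} (hφ' : IsIrrChar φ') (hφ : MemIrrBlock (res hNH φ') b)
    (hJ : ∀ (L : Subgroup A) (_ : N ≤ L) (_ : L ≤ J) (h : L ≤ H),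
      SameBlock R (resTop L χ') (res h φ'))
    (hstab : BlockStable R (res hI.le_right φ') (Subgroup.normalizer (I : Set A))) :
    ∃ χ₁ : A → K, IsIrrChar χ₁ ∧ resTop J χ₁ = resTop J χ' ∧
      ∀ (L : Subgroup A) (_ : N ≤ L) (h : L ≤ H), SameBlock R (resTop L χ₁) (res h φ') := by
  obtain ⟨n, ρ, hρ, rfl⟩ := hχ'
  obtain ⟨m, σ, hσ, rfl⟩ := hφ'
  have := neZero_of_isIrreducible hρ
  have := neZero_of_isIrreducible hσ
  have : NeZero (Monoid.exponent A) := ⟨Monoid.exponent_ne_zero_of_finite⟩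
  have hexpN : ∀ g : N, g ^ Monoid.exponent A = 1 := fun g =>
    Subtype.ext (Monoid.pow_exponent_eq_one (g : A))
  obtain ⟨hρN, hρb⟩ := hasScalarEnds_of_memIrrBlock
    (ρ := (MonoidHom.comp ρ N.subtype : Representation K N (Fin n → K))) hexpN hb hχ
  obtain ⟨hσN, hσb⟩ := hasScalarEnds_of_memIrrBlock
    (ρ := (MonoidHom.comp σ (Subgroup.inclusion hNH) : Representation K N (Fin m → K))) hexpN hb hφ
  obtain ⟨ν, hνJ, hratio⟩ := exists_linear_of_sameBlock 𝔞 red hred hNJ hlin hb hH hNH hI hIJ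
    hρN hσN hρb hσb hJ hstab
  have hνN : ∀ x ∈ N, ν x = 1 := fun x hx => hνJ x (hNJ hx)
  have htwN : HasScalarEnds (MonoidHom.comp (ρ.twist ν) N.subtype :
      Representation K N (Fin n → K)) := by
    convert hρN using 1
    ext1 x
    change algebraMap R K (ν x) • ρ x = ρ x
    rw [hνN x x.2, Units.val_one, map_one, one_smul]
  refine ⟨(ρ.twist ν).character, ⟨n, ρ.twist ν,
    (HasScalarEnds.of_comp N.subtype htwN).isIrreducible, rfl⟩, ?_, ?_⟩
  · funext x
    change LinearMap.trace K _ (algebraMap R K (ν x) • ρ x) = LinearMap.trace K _ (ρ x)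
    rw [hνJ x x.2, Units.val_one, map_one, one_smul]
  · intro L hNL hLH
    have htwL : HasScalarEnds (MonoidHom.comp (ρ.twist ν) L.subtype :
      Representation K L (Fin n → K)) := HasScalarEnds.of_comp (Subgroup.inclusion hNL) htwN
    have hσL : HasScalarEnds (MonoidHom.comp σ (Subgroup.inclusion hLH) :
      Representation K L (Fin m → K)) := HasScalarEnds.of_comp (Subgroup.inclusion hNL) hσN
    refine sameBlock_of_congr red R₀ htwL hσL fun z s t hz hs ht => ?_
    have hs' : ActsBy (Representation.twist (ν.comp H.subtype)
        (MonoidHom.comp ρ H.subtype : Representation K H (Fin n → K))) (incl R L z) s :=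
      (actsBy_incl_iff hLH).mpr hs
    exact congr_twist_of_ratio red hNL hLH hρN hσN hνN hratio hz hs'
      ((actsBy_incl_iff (ρ := σ) hLH).mpr ht)

end Main

theorem lemma1p14
    {ℓ : ℕ} [Fact ℓ.Prime]
    {K : Type*} [Field K] [Algebra ℚ_[ℓ] K] [FiniteDimensional ℚ_[ℓ] K]
    [Algebra ℤ_[ℓ] K] [IsScalarTower ℤ_[ℓ] ℚ_[ℓ] K]
    {A : Type*} [Group A] [Finite A] [HasEnoughRootsOfUnity K (Monoid.exponent A)]
    (N J : Subgroup A) [N.Normal] [J.Normal] (hNJ : N ≤ J)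
    (hab : IsMulCommutative (J.map (QuotientGroup.mk' N)))
    (hsolv : Group.IsSolvable (A ⧸ N))
    (hlin : ∀ (H : Subgroup (A ⧸ J)) [H.Normal],
      H ≤ (commutator A ⊔ J).map (QuotientGroup.mk' J) →
        invLin K ((MulAut.conjNormal (H := H)).comp (QuotientGroup.mk' J)) = {1})
    (b : MonoidAlgebra (integralClosure ℤ_[ℓ] K) N) (hb : IsBlock b)
    (I : Subgroup A) (hI : IsHallCompl ℓ N I (ramificationGroup ⊤ N b))
    (hIJ : ∀ a : A, ∃ n ∈ Subgroup.normalizer (I : Set A), ∃ j ∈ J, a = n * j)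
    (χ φ : N → K) (hχ : MemIrrBlock χ b) (hφ : MemIrrBlock φ b)
    (χ' : A → K) (hχ' : IsIrrChar χ') (hχχ' : resTop N χ' = χ)
    (φ' : ramificationGroup ⊤ N b → K) (hφ' : IsIrrChar φ')
    (hφφ' : res (le_ramificationGroup le_top b) φ' = φ)
    (hJ : ∀ (J₁ : Subgroup A) (_ : N ≤ J₁) (h₁ : J₁ ≤ ramificationGroup J N b),
      SameBlock (integralClosure ℤ_[ℓ] K) (resTop J₁ χ')
        (res (h₁.trans (ramificationGroup_mono le_top N b)) φ'))
    (hstab : BlockStable (integralClosure ℤ_[ℓ] K) (res hI.le_right φ')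
      (Subgroup.normalizer (I : Set A))) :
    ∃ χ₁ : A → K, IsIrrChar χ₁ ∧ resTop J χ₁ = resTop J χ' ∧
      ∀ (J₂ : Subgroup A) (_ : N ≤ J₂) (h₂ : J₂ ≤ ramificationGroup ⊤ N b),
        SameBlock (integralClosure ℤ_[ℓ] K) (resTop J₂ χ₁) (res h₂ φ') := by
  have : CharZero K := charZero_of_injective_algebraMap (algebraMap ℚ_[ℓ] K).injective
  have : Module.Finite ℤ_[ℓ] (integralClosure ℤ_[ℓ] K) :=
    IsIntegralClosure.finite ℤ_[ℓ] ℚ_[ℓ] K _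
  have hinj : Function.Injective (algebraMap ℤ_[ℓ] (integralClosure ℤ_[ℓ] K)) := by
    refine Function.Injective.of_comp (f := algebraMap (integralClosure ℤ_[ℓ] K) K) ?_
    rw [← RingHom.coe_comp, ← IsScalarTower.algebraMap_eq, IsScalarTower.algebraMap_eq ℤ_[ℓ] ℚ_[ℓ]]
    exact (algebraMap ℚ_[ℓ] K).injective.comp (IsFractionRing.injective ℤ_[ℓ] ℚ_[ℓ])
  -- Any maximal ideal above `ℓ` serves for the reduction; completeness is used over `ℤ_[ℓ]`, over
  -- which the ring of integers is finite.
  obtain ⟨𝔪, h𝔪, hcomap⟩ := Ideal.exists_ideal_over_maximal_of_isIntegral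
    (S := integralClosure ℤ_[ℓ] K) (IsLocalRing.maximalIdeal ℤ_[ℓ])
    (by rw [(RingHom.injective_iff_ker_eq_bot _).mp hinj]; exact bot_le)
  let := Ideal.Quotient.field 𝔪
  have hred : ∀ r ∈ IsLocalRing.maximalIdeal ℤ_[ℓ],
      Ideal.Quotient.mk 𝔪 (algebraMap ℤ_[ℓ] (integralClosure ℤ_[ℓ] K) r) = 0 := fun r hr => by
    rw [Ideal.Quotient.eq_zero_iff_mem, ← Ideal.mem_comap, hcomap]
    exact hr
  have : CharP (integralClosure ℤ_[ℓ] K ⧸ 𝔪) ℓ := by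
    refine (CharP.charP_iff_prime_eq_zero Fact.out).mpr ?_
    have h1 := hred (ℓ : ℤ_[ℓ]) (by
      rw [PadicInt.maximalIdeal_eq_span_p]
      exact Ideal.mem_span_singleton_self _)
    rwa [map_natCast, map_natCast] at h1
  have : Finite (ℤ_[ℓ] ⧸ IsLocalRing.maximalIdeal ℤ_[ℓ]) :=
    inferInstanceAs (Finite (IsLocalRing.ResidueField ℤ_[ℓ]))
  subst hχχ' hφφ'
  -- The last function uses `J[b] = J ∩ A[b]` to apply the hypothesis on `J[b]` to subgroups of `J`
  -- inside `A[b]`.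
  exact exists_isIrrChar_sameBlock (H := ramificationGroup ⊤ N b) (IsLocalRing.maximalIdeal ℤ_[ℓ]) (Ideal.Quotient.mk 𝔪)
    hred hNJ hlin hb (fun _ hg => And.right hg) (le_ramificationGroup le_top b) hI hIJ hχ' hχ hφ' hφ
    (fun L hNL hLJ hL => hJ L hNL fun _ hx => ⟨hLJ hx, (hL hx).2⟩) hstab
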